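/- For $N\ge 1$ let $S^{N-1}(\sqrt N)=\{v\in\mathbb R^N:\ \sum_{j=1}^N v_j^2=N\}$ and let $\sigma^N$ be the uniform probability measure on it. Let $\gamma(\mathrm dv)=(2\pi)^{-1/2}e^{-v^2/2}\,\mathrm dv$ be the standard Gaussian measure on $\mathbb R$. For probability measures $\mu,\nu$ on the same space, let $H(\mu|\nu)=\int h\log h\,\mathrm d\nu\in[0,+\infty]$ with $h=\mathrm d\mu/\mathrm d\nu$ if $\mu\ll\nu$, and $H(\mu|\nu)=+\infty$ otherwise. Let $f$ be a probability density on $\mathbb R$ such that $$\int_{\mathbb R} f(v)\,v^2\,\mathrm dv=1,\qquad \int_{\mathbb R} f(v)\,v^4\,\mathrm dv<+\infty,\qquad f\in L^\infty(\mathbb R),$$ and let $\nu(\mathrm dv)=f(v)\,\mathrm dv$. Let $\nu^{(N)}$ be the conditioned $N$-fold tensor product of $\nu$, i.e. the probability measure $$\nu^{(N)}=\frac{\prod_{j=1}^N f(v_j)}{Z_N}\,\sigma^N,\qquad Z_N=\int_{S^{N-1}(\sqrt N)}\prod_{j=1}^N f(v_j)\,\mathrm d\sigma^N(v),$$ which is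 well defined for all sufficiently large $N$. For each $N$ let $\mu^{(N)}$ be a probability measure on $S^{N-1}(\sqrt N)$, and suppose that $$\frac{H(\mu^{(N)}|\nu^{(N)})}{N}\xrightarrow[N\to\infty]{}0.$$ Then $$\frac{H(\mu^{(N)}|\sigma^N)}{N}\xrightarrow[N\to\infty]{}H(\nu|\gamma).$$ -/

import Mathlib

/-
Slicing the sphere by the first two coordinates expresses `Z f N` through the sum of `N - 2`
independent squares. Up to a factor depending only on `N`, it is at most a constant times the
`(N - 2)`-th power of the mass of `f`; when `f` has mass and second moment one, it is not
exponentially small, because a bounded window near the mean of the sum of squares has a probability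
that is not exponentially small. Hence, for every bounded `g`, the exponential growth rate of
`Z g N / Z f N` is at most the logarithm of the mass of `g`.

This comparison is used twice. The tensor product of the standard Gaussian density is constant on
the sphere, which gives the limit of `log (Z f N) / N`. The powers `g = f ^ (1 + t)` control the
exponential moments of `∑ⱼ log f(vⱼ)` under the conditioned measure; with the Donsker–Varadhan
inequality and the derivative at `t = 0` they give the limit `∫ f log f` of
`N⁻¹ ∫ ∑ⱼ log f(vⱼ) dμ_N`. The chain rule
`H(μ_N | σ^N) = H(μ_N | ν_N) + ∫ ∑ⱼ log f(vⱼ) dμ_N - log (Z f N)`, with `ν_N` the conditioned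
measure, concludes.
-/

open MeasureTheory ProbabilityTheory InformationTheory Filter Topology
open scoped ENNReal

noncomputable section

namespace Kac

/-- The sphere `S^{N-1}(√N)` of radius `√N`, centred at the origin of Euclidean `ℝ^N`. -/
abbrev Sphere (N : ℕ) : Set (EuclideanSpace ℝ (Fin N)) :=
  Metric.sphere 0 (Real.sqrt N)

/-- The dilation `x ↦ √N x` from the unit sphere to `S^{N-1}(√N)`. -/
def dilate (N : ℕ) (x : Metric.sphere (0 : EuclideanSpace ℝ (Fin N)) 1) : Sphere N :=
  ⟨Real.sqrt N • (x : EuclideanSpace ℝ (Fin N)), by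
    simp [norm_smul, abs_of_nonneg (Real.sqrt_nonneg (N : ℝ))]⟩

/-- `σ^N`, the uniform probability measure on `S^{N-1}(√N)` (for `N ≥ 1`): the normalized surface
measure of the unit sphere, transported by the dilation of ratio `√N`. -/
def sigma (N : ℕ) : Measure (Sphere N) :=
  (((volume : Measure (EuclideanSpace ℝ (Fin N))).toSphere Set.univ)⁻¹ •
    (volume : Measure (EuclideanSpace ℝ (Fin N))).toSphere).map (dilate N)

/-- The tensor product `f^{⊗N}(v) = ∏ⱼ f(vⱼ)`, restricted to `S^{N-1}(√N)`. -/
def tensor (f : ℝ → ℝ) (N : ℕ) (v : Sphere N) : ℝ≥0∞ :=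
  ∏ j : Fin N, ENNReal.ofReal (f ((v : EuclideanSpace ℝ (Fin N)) j))

/-- The normalization `Z_N(f, √N) = ∫ f^{⊗N} dσ^N`. -/
def Z (f : ℝ → ℝ) (N : ℕ) : ℝ≥0∞ :=
  ∫⁻ v, tensor f N v ∂(sigma N)

/-- The conditioned tensor product `[(f dv)^{⊗N}]` on `S^{N-1}(√N)`, that is
`f^{⊗N} / Z_N(f, √N) · σ^N`. -/
def conditioned (f : ℝ → ℝ) (N : ℕ) : Measure (Sphere N) :=
  (sigma N).withDensity fun v => tensor f N v / Z f N

/-- The measure `f(v) dv` on `ℝ`. -/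
def densityMeasure (f : ℝ → ℝ) : Measure ℝ :=
  volume.withDensity fun v => ENNReal.ofReal (f v)

end Kac

end

noncomputable section

namespace Kac

open Set Real

section ConvPow

variable {M : Type*} [MeasurableSpace M]

/-- The `n`-fold convolution power of a measure `ρ` on an additive monoid: for a probability
measure, the law of a sum of `n` independent variables of law `ρ`. -/
def convPow [AddMonoid M] (ρ : Measure M) : ℕ → Measure M
  | 0 => Measure.dirac 0
  | n + 1 => ρ ∗ convPow ρ n

instance sFinite_convPow [AddMonoid M] (ρ : Measure M) [SFinite ρ] (n : ℕ) :
    SFinite (convPow ρ n) := by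
  induction n <;> unfold convPow <;> infer_instance

lemma conv_mono [AddMonoid M] [MeasurableAdd₂ M] {μ μ' ν ν' : Measure M} [SFinite ν] [SFinite ν']
    (hμ : μ ≤ μ') (hν : ν ≤ ν') : μ ∗ ν ≤ μ' ∗ ν' := by
  refine Measure.le_iff.2 fun s hs => ?_
  have hm : Measurable (s.indicator (1 : M → ℝ≥0∞)) := measurable_one.indicator hs
  rw [← lintegral_indicator_one hs, ← lintegral_indicator_one hs,
    Measure.lintegral_conv hm, Measure.lintegral_conv hm]
  exact lintegral_mono' hμ fun x => lintegral_mono' hν le_rfl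

lemma conv_univ [AddMonoid M] [MeasurableAdd₂ M] (μ ν : Measure M) [SFinite ν] :
    (μ ∗ ν) univ = μ univ * ν univ := by
  rw [← lintegral_one, Measure.lintegral_conv measurable_const]
  simp [mul_comm]

section AddMonoid

variable [AddMonoid M] [MeasurableAdd₂ M] (ρ : Measure M) [SFinite ρ]

lemma convPow_one : convPow ρ 1 = ρ := by simp [convPow]

lemma convPow_add (m n : ℕ) : convPow ρ (m + n) = convPow ρ m ∗ convPow ρ n := by
  induction m with
  | zero => simp [convPow]
  | succ m ih => rw [Nat.succ_add, convPow, ih, convPow, Measure.conv_assoc]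

lemma convPow_mul (m n : ℕ) : convPow ρ (m * n) = convPow (convPow ρ m) n := by
  induction n with
  | zero => simp [convPow]
  | succ n ih => rw [mul_add, mul_one, add_comm, convPow_add, ih, convPow]

lemma convPow_univ (n : ℕ) : convPow ρ n univ = ρ univ ^ n := by
  induction n with
  | zero => simp [convPow]
  | succ n ih => rw [convPow, conv_univ, ih, pow_succ']

instance isProbabilityMeasure_convPow (ρ : Measure M) [IsProbabilityMeasure ρ] (n : ℕ) :
    IsProbabilityMeasure (convPow ρ n) :=
  ⟨by simp [convPow_univ]⟩

end AddMonoid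

lemma convPow_absolutelyContinuous [AddCommGroup M] [MeasurableAdd₂ M] {ρ κ : Measure M}
    [SFinite ρ] [κ.IsAddLeftInvariant] (hρ : ρ ≪ κ) {n : ℕ} (hn : n ≠ 0) : convPow ρ n ≪ κ := by
  obtain ⟨n, rfl⟩ := Nat.exists_eq_succ_of_ne_zero hn
  rw [convPow, Measure.conv_comm]
  exact Measure.conv_absolutelyContinuous hρ

lemma hasLaw_sum_range_convPow [AddCommMonoid M] [MeasurableAdd₂ M] {ρ : Measure M} [SFinite ρ]
    {Ω : Type*} {mΩ : MeasurableSpace Ω} {P : Measure Ω} [IsProbabilityMeasure P] {X : ℕ → Ω → M}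
    (hX : ∀ i, Measurable (X i)) (hlaw : ∀ i, HasLaw (X i) ρ P) (hind : iIndepFun X P) (n : ℕ) :
    HasLaw (∑ i ∈ Finset.range n, X i) (convPow ρ n) P := by
  induction n with
  | zero => exact ⟨by fun_prop, by simp [Pi.zero_def, convPow]⟩
  | succ n ih =>
    refine ⟨by fun_prop, ?_⟩
    rw [Finset.sum_range_succ, (hind.indepFun_sum_range_succ hX n).map_add_eq_map_conv_map
      (by fun_prop) (hX n), ih.map_eq, (hlaw n).map_eq, convPow, Measure.conv_comm]

end ConvPow

lemma tendsto_convPow_ball {E : Type*} [NormedAddCommGroup E] [NormedSpace ℝ E] [CompleteSpace E]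
    [SecondCountableTopology E] [MeasurableSpace E] [BorelSpace E] {ρ : Measure E}
    [IsProbabilityMeasure ρ] (hρ : Integrable id ρ) {ε : ℝ} (hε : 0 < ε) :
    Tendsto (fun n : ℕ => convPow ρ n (Metric.ball ((n : ℝ) • ∫ x, x ∂ρ) (n * ε))) atTop
      (𝓝 1) := by
  obtain ⟨Ω, _, P, X, hX, hlaw, hind, _⟩ := exists_iid ℕ ρ
  have hmean : ∫ ω, X 0 ω ∂P = ∫ x, x ∂ρ := (hlaw 0).integral_eq
  have hlln := tendstoInMeasure_of_tendsto_ae (fun n => by fun_prop)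
    (strong_law_ae X ((integrable_map_measure aestronglyMeasurable_id (hX 0).aemeasurable).1
      ((hlaw 0).map_eq ▸ hρ)) (fun _ _ h => hind.indepFun h)
      fun i => (hlaw i).identDistrib (hlaw 0))
  have hcompl := ENNReal.Tendsto.sub (tendsto_const_nhds (x := (1 : ℝ≥0∞)))
    ((tendstoInMeasure_iff_dist.1 hlln) ε hε) (.inl ENNReal.one_ne_top)
  rw [tsub_zero] at hcompl
  refine hcompl.congr' ?_
  filter_upwards [eventually_gt_atTop 0] with n hn
  have hn : (0 : ℝ) < n := by exact_mod_cast hn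
  have hball : Metric.ball ((n : ℝ) • ∫ x, x ∂ρ) (n * ε) =
      {x | ε ≤ dist ((n : ℝ)⁻¹ • x) (∫ x, x ∂ρ)}ᶜ := by
    ext x
    obtain ⟨y, rfl⟩ : ∃ y, x = (n : ℝ) • y := ⟨_, (smul_inv_smul₀ hn.ne' x).symm⟩
    rw [mem_compl_iff, mem_ofPred_eq, not_le, Metric.mem_ball, dist_smul₀, inv_smul_smul₀ hn.ne',
      Real.norm_of_nonneg hn.le, mul_lt_mul_iff_right₀ hn]
  rw [hball, prob_compl_eq_one_sub (measurableSet_le (by fun_prop) (by fun_prop)),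
    ← (hasLaw_sum_range_convPow hX hlaw hind n).map_eq, Measure.map_apply (by fun_prop)
    (measurableSet_le (by fun_prop) (by fun_prop)), hmean]
  simp only [preimage_ofPred_eq, Finset.sum_apply]

section Overlap

lemma smul_restrict_mono {α : Type*} [MeasurableSpace α] {κ μ : Measure α} {c c' : ℝ≥0∞}
    {A A' : Set α} (hc : c' ≤ c) (hA : A' ⊆ A) (h : c • κ.restrict A ≤ μ) :
    c' • κ.restrict A' ≤ μ := by
  refine le_trans ?_ h
  gcongr

lemma exists_smul_restrict_le {α : Type*} [MeasurableSpace α] {μ κ : Measure α} [SFinite κ]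
    [μ.HaveLebesgueDecomposition κ] (hμ : μ ≪ κ) {I : Set α} (hI : MeasurableSet I)
    (hμI : μ I ≠ 0) :
    ∃ A ⊆ I, MeasurableSet A ∧ κ A ≠ 0 ∧ ∃ c : ℝ≥0∞, c ≠ 0 ∧ c • κ.restrict A ≤ μ := by
  have hh : Measurable (μ.rnDeriv κ) := Measure.measurable_rnDeriv _ _
  obtain ⟨n, hn⟩ : ∃ n : ℕ, κ (I ∩ {x | (n : ℝ≥0∞)⁻¹ < μ.rnDeriv κ x}) ≠ 0 := by
    by_contra! hnull
    refine hμI ?_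
    rw [← Measure.setLIntegral_rnDeriv hμ, setLIntegral_eq_zero_iff hI hh]
    filter_upwards [ae_all_iff.2 fun n => measure_eq_zero_iff_ae_notMem.1 (hnull n)] with x hx hxI
    by_contra hne
    obtain ⟨n, hn⟩ := ENNReal.exists_inv_nat_lt hne
    exact hx n ⟨hxI, hn⟩
  refine ⟨_, inter_subset_left, hI.inter (measurableSet_lt measurable_const hh), hn,
    (n : ℝ≥0∞)⁻¹, by simp, Measure.le_iff.2 fun s hs => ?_⟩
  rw [Measure.smul_apply, smul_eq_mul, Measure.restrict_apply hs, ← setLIntegral_const]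
  calc ∫⁻ _ in s ∩ (I ∩ {x | (n : ℝ≥0∞)⁻¹ < μ.rnDeriv κ x}), (n : ℝ≥0∞)⁻¹ ∂κ
      ≤ ∫⁻ x in s ∩ (I ∩ {x | (n : ℝ≥0∞)⁻¹ < μ.rnDeriv κ x}), μ.rnDeriv κ x ∂κ :=
        setLIntegral_mono hh fun x hx => hx.2.2.le
    _ ≤ ∫⁻ x in s, μ.rnDeriv κ x ∂κ := lintegral_mono_set inter_subset_left
    _ = μ s := Measure.setLIntegral_rnDeriv hμ s

variable {G : Type*} [AddCommGroup G] [MeasurableSpace G] [MeasurableAdd₂ G] [MeasurableSub₂ G]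
  {κ : Measure G} [SFinite κ] [κ.IsAddLeftInvariant] {A B : Set G}

lemma restrict_conv_restrict_eq_withDensity (hB : MeasurableSet B) :
    κ.restrict A ∗ κ.restrict B = κ.withDensity fun z => κ (A ∩ {t | z - t ∈ B}) := by
  have : Measurable (B.indicator (1 : G → ℝ≥0∞)) := measurable_one.indicator hB
  have hdensity : ∀ z, κ (A ∩ {t | z - t ∈ B}) = ∫⁻ t in A, B.indicator 1 (z - t) ∂κ := fun z => by
    have hT : MeasurableSet {t | z - t ∈ B} := hB.preimage (by fun_prop)
    rw [inter_comm, ← Measure.restrict_apply hT, ← lintegral_indicator_one hT]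
    rfl
  refine Measure.ext_of_lintegral _ fun φ hφ => ?_
  simp_rw [hdensity]
  rw [Measure.lintegral_conv hφ, lintegral_withDensity_eq_lintegral_mul _
    (Measurable.lintegral_prod_right' (f := fun q : G × G => B.indicator 1 (q.1 - q.2))
      (by fun_prop)) hφ]
  calc ∫⁻ x in A, ∫⁻ y in B, φ (x + y) ∂κ ∂κ
      = ∫⁻ x in A, ∫⁻ z, B.indicator 1 (z - x) * φ z ∂κ ∂κ := by
        refine lintegral_congr fun x => ?_
        rw [← lintegral_indicator hB, ← lintegral_add_left_eq_self
          (fun z => B.indicator 1 (z - x) * φ z) x]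
        refine lintegral_congr fun y => ?_
        by_cases h : y ∈ B <;> simp [h]
    _ = ∫⁻ z, (∫⁻ t in A, B.indicator 1 (z - t) ∂κ) * φ z ∂κ := by
        rw [lintegral_lintegral_swap (by fun_prop)]
        refine lintegral_congr fun z => ?_
        rw [lintegral_mul_const _ (by fun_prop)]

lemma smul_restrict_le_conv {μ ν : Measure G} [SFinite ν] {U : Set G} (hB : MeasurableSet B)
    (hU : MeasurableSet U) {a b δ : ℝ≥0∞} (hμ : a • κ.restrict A ≤ μ)
    (hν : b • κ.restrict B ≤ ν) (hδ : ∀ z ∈ U, δ ≤ κ (A ∩ {t | z - t ∈ B})) :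
    (a * b * δ) • κ.restrict U ≤ μ ∗ ν := by
  have hoverlap : δ • κ.restrict U ≤ κ.restrict A ∗ κ.restrict B := by
    rw [restrict_conv_restrict_eq_withDensity hB, ← withDensity_const, ← withDensity_indicator hU]
    refine withDensity_mono (ae_of_all _ fun z => indicator_le hδ z)
  refine le_trans ?_ (conv_mono hμ hν)
  rw [Measure.conv_smul_left, Measure.conv_smul_right, smul_smul, mul_smul]
  gcongr

end Overlap

open scoped Pointwise in
lemma exists_eventually_le_measure_inter_sub_mem {G : Type*} [AddCommGroup G] [TopologicalSpace G]
    [IsTopologicalAddGroup G] [LocallyCompactSpace G] [SecondCountableTopology G]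
    [T2Space G] [MeasurableSpace G] [BorelSpace G] {κ : Measure G} [κ.IsAddHaarMeasure]
    [κ.InnerRegular]
    {A B : Set G} (hA : MeasurableSet A) (hB : MeasurableSet B) (hA₀ : κ A ≠ 0) (hB₀ : κ B ≠ 0) :
    ∃ a ∈ A, ∃ b ∈ B, ∃ δ : ℝ≥0∞, δ ≠ 0 ∧
      ∀ᶠ z in 𝓝 (a + b), δ ≤ κ (A ∩ {t | z - t ∈ B}) := by
  have hmeas : ∀ z, MeasurableSet {t | z - t ∈ B} := fun z => hB.preimage (by fun_prop)
  obtain ⟨z, hz⟩ : ∃ z, κ (A ∩ {t | z - t ∈ B}) ≠ 0 := by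
    by_contra! hnull
    have hmass := conv_univ (κ.restrict A) (κ.restrict B)
    rw [restrict_conv_restrict_eq_withDensity hB] at hmass
    simp [hnull, hA₀, hB₀] at hmass
  obtain ⟨K, hKA, hK, hK₀⟩ := (hA.inter (hmeas z)).exists_lt_isCompact (pos_iff_ne_zero.2 hz)
  obtain ⟨a, ha⟩ := nonempty_of_measure_ne_zero hK₀.ne'
  refine ⟨a, (hKA ha).1, z - a, (hKA ha).2, κ K / 2, by simp [hK₀.ne'], ?_⟩
  have hshift : Tendsto (fun z' => z' - z) (𝓝 (a + (z - a))) (𝓝 0) := by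
    rw [add_sub_cancel]
    exact tendsto_sub_nhds_zero_iff.2 tendsto_id
  have hclose := eventually_nhds_zero_measure_vadd_sdiff_lt (μ := κ) hK hK.isClosed
    (ENNReal.half_pos hK₀.ne').ne'
  filter_upwards [hshift.eventually hclose] with z' hz'
  have hsub : ((z' - z) +ᵥ K) ∩ K ⊆ A ∩ {t | z' - t ∈ B} := by
    rintro _ ⟨⟨t, ht, rfl⟩, ht'⟩
    refine ⟨(hKA ht').1, ?_⟩
    have : z - t ∈ B := (hKA ht).2
    simpa only [mem_ofPred_eq, vadd_eq_add, ← sub_sub, sub_sub_cancel] using this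
  refine le_trans ?_ (measure_mono hsub)
  have hsplit :=
    measure_inter_add_sdiff₀ (μ := κ) ((z' - z) +ᵥ K) hK.measurableSet.nullMeasurableSet
  rw [measure_vadd] at hsplit
  refine (ENNReal.add_le_add_iff_right (ENNReal.div_ne_top
    (hK.measure_lt_top (μ := κ)).ne two_ne_zero)).1 ?_
  rw [ENNReal.add_halves]
  exact hsplit.ge.trans (by gcongr)

section MinorizedNear

open Metric

/-- The measure `μ` dominates a positive multiple of Lebesgue measure on a neighbourhood
of `x`. -/
def IsMinorizedNear (μ : Measure ℝ) (x : ℝ) : Prop :=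
  ∃ c : ℝ≥0∞, c ≠ 0 ∧ ∃ r > 0, c • volume.restrict (ball x r) ≤ μ

lemma le_volume_ball_inter {x₁ x₂ r₁ r₂ s z : ℝ} (h₁ : s ≤ 2 * r₁) (h₂ : s ≤ 2 * r₂)
    (hz : z ∈ ball (x₁ + x₂) (r₁ + r₂ - s)) :
    ENNReal.ofReal s ≤ volume (ball x₁ r₁ ∩ {t | z - t ∈ ball x₂ r₂}) := by
  rw [mem_ball, Real.dist_eq, abs_lt] at hz
  have hsub : Ioo (max (x₁ - r₁) (z - x₂ - r₂)) (min (x₁ + r₁) (z - x₂ + r₂)) ⊆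
      ball x₁ r₁ ∩ {t | z - t ∈ ball x₂ r₂} := by
    intro t ht
    simp only [mem_Ioo, max_lt_iff, lt_min_iff] at ht
    simp only [mem_inter_iff, mem_ofPred_eq, mem_ball, Real.dist_eq, abs_lt]
    refine ⟨⟨?_, ?_⟩, ?_, ?_⟩ <;> linarith [ht.1.1, ht.1.2, ht.2.1, ht.2.2]
  refine le_trans ?_ (measure_mono hsub)
  rw [Real.volume_Ioo]
  refine ENNReal.ofReal_le_ofReal ?_
  rw [le_sub_iff_add_le, le_min_iff]
  constructor <;> rw [← le_sub_iff_add_le', max_le_iff] <;> constructor <;> linarith [hz.1, hz.2]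

lemma smul_restrict_ball_le_conv {μ ν : Measure ℝ} [SFinite ν] {x₁ x₂ r₁ r₂ s : ℝ}
    {c₁ c₂ : ℝ≥0∞} (hμ : c₁ • volume.restrict (ball x₁ r₁) ≤ μ)
    (hν : c₂ • volume.restrict (ball x₂ r₂) ≤ ν) (h₁ : s ≤ 2 * r₁) (h₂ : s ≤ 2 * r₂) :
    (c₁ * c₂ * ENNReal.ofReal s) • volume.restrict (ball (x₁ + x₂) (r₁ + r₂ - s)) ≤ μ ∗ ν :=
  smul_restrict_le_conv measurableSet_ball measurableSet_ball hμ hν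
    fun _ hz => le_volume_ball_inter h₁ h₂ hz

lemma isOpen_setOf_isMinorizedNear (μ : Measure ℝ) : IsOpen {x | IsMinorizedNear μ x} := by
  refine isOpen_iff.2 fun x ⟨c, hc, r, hr, hle⟩ => ⟨r / 2, by positivity, fun y hy => ?_⟩
  exact ⟨c, hc, r / 2, by positivity, smul_restrict_mono le_rfl
    (ball_subset_ball' (by linarith [mem_ball.1 hy])) hle⟩

lemma IsMinorizedNear.conv {μ ν : Measure ℝ} [SFinite ν] {x y : ℝ} (hμ : IsMinorizedNear μ x)
    (hν : IsMinorizedNear ν y) : IsMinorizedNear (μ ∗ ν) (x + y) := by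
  obtain ⟨c, hc, r, hr, hle⟩ := hμ
  obtain ⟨c', hc', r', hr', hle'⟩ := hν
  have : 0 < min r r' := lt_min hr hr'
  refine ⟨c * c' * ENNReal.ofReal (min r r'), by simp [hc, hc', hr, hr'], r + r' - min r r', ?_,
    smul_restrict_ball_le_conv hle hle' ?_ ?_⟩ <;>
  linarith [min_le_left r r', min_le_right r r']

lemma IsMinorizedNear.convPow {μ : Measure ℝ} [SFinite μ] {x : ℝ} (hμ : IsMinorizedNear μ x)
    {n : ℕ} (hn : n ≠ 0) : IsMinorizedNear (convPow μ n) (n * x) := by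
  induction n, Nat.one_le_iff_ne_zero.2 hn using Nat.le_induction with
  | base => simpa [convPow_one] using hμ
  | succ n hle ih =>
    rw [Kac.convPow]
    convert hμ.conv (ih (by lia)) using 1
    push_cast
    ring

lemma exists_isMinorizedNear_conv {μ ν : Measure ℝ} [SigmaFinite μ] [SigmaFinite ν]
    (hμ : μ ≪ volume) (hν : ν ≪ volume) {I J : Set ℝ} (hI : MeasurableSet I)
    (hJ : MeasurableSet J) (hμI : μ I ≠ 0) (hνJ : ν J ≠ 0) :
    ∃ x ∈ I, ∃ y ∈ J, IsMinorizedNear (μ ∗ ν) (x + y) := by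
  obtain ⟨A, hAI, hA, hA₀, a, ha, hleA⟩ := exists_smul_restrict_le hμ hI hμI
  obtain ⟨B, hBJ, hB, hB₀, b, hb, hleB⟩ := exists_smul_restrict_le hν hJ hνJ
  obtain ⟨x, hx, y, hy, δ, hδ, hnear⟩ := exists_eventually_le_measure_inter_sub_mem hA hB hA₀ hB₀
  obtain ⟨r, hr, hball⟩ := eventually_nhds_iff_ball.1 hnear
  exact ⟨x, hAI hx, y, hBJ hy, a * b * δ, by simp [ha, hb, hδ], r, hr,
    smul_restrict_le_conv hB measurableSet_ball hleA hleB hball⟩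

lemma IsMinorizedNear.exists_convPow {μ : Measure ℝ} [SFinite μ] {x y a : ℝ}
    (hx : IsMinorizedNear μ x) (hy : IsMinorizedNear μ y) (hxa : x < a) (hay : a < y) :
    ∃ n : ℕ, IsMinorizedNear (Kac.convPow μ n) (n * a) := by
  -- Moving `x` slightly makes `a` a rational convex combination of the two points.
  obtain ⟨q, hq, hq₀⟩ : ∃ q : ℚ, IsMinorizedNear μ (a - q * (y - a)) ∧ 0 < q := by
    have hopen : IsOpen {t : ℝ | IsMinorizedNear μ (a - t * (y - a)) ∧ 0 < t} :=
      ((isOpen_setOf_isMinorizedNear μ).preimage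
        (f := fun t : ℝ => a - t * (y - a)) (by fun_prop)).inter isOpen_Ioi
    obtain ⟨q, hq⟩ := Rat.denseRange_cast.exists_mem_open hopen
      ⟨(a - x) / (y - a), by rwa [div_mul_cancel₀ _ (sub_pos.2 hay).ne', sub_sub_cancel],
        div_pos (sub_pos.2 hxa) (sub_pos.2 hay)⟩
    exact ⟨q, hq.1, by exact_mod_cast hq.2⟩
  obtain ⟨i, hi⟩ := Int.eq_ofNat_of_zero_le (Rat.num_pos.2 hq₀).le
  have hi₀ : i ≠ 0 := by
    rintro rfl
    exact hq₀.ne' (Rat.num_eq_zero.1 hi)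
  have hqi : (q.den : ℝ) * q = i := by
    have := q.den_mul_eq_num
    rw [hi] at this
    exact_mod_cast this
  have hnear := (hq.convPow q.den_ne_zero).conv (hy.convPow hi₀)
  rw [← convPow_add] at hnear
  refine ⟨q.den + i, ?_⟩
  convert hnear using 1
  push_cast
  linear_combination (y - a) * hqi

lemma exists_isMinorizedNear_convPow_mean {ρ : Measure ℝ} [IsProbabilityMeasure ρ]
    (hρ : ρ ≪ volume) (hint : Integrable id ρ) :
    ∃ k : ℕ, IsMinorizedNear (convPow ρ k) (k * ∫ x, x ∂ρ) := by
  set a := ∫ x, x ∂ρ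
  have hIio : ρ (Iio a) ≠ 0 := by
    rw [measure_congr (hρ.ae_eq Iio_ae_eq_Iic)]
    exact (measure_le_integral_pos hint).ne'
  have hIoi : ρ (Ioi a) ≠ 0 := by
    rw [measure_congr (hρ.ae_eq Ioi_ae_eq_Ici)]
    exact (measure_integral_le_pos hint).ne'
  obtain ⟨x, hx, x', hx', hlower⟩ :=
    exists_isMinorizedNear_conv hρ hρ measurableSet_Iio measurableSet_Iio hIio hIio
  obtain ⟨y, hy, y', hy', hupper⟩ :=
    exists_isMinorizedNear_conv hρ hρ measurableSet_Ioi measurableSet_Ioi hIoi hIoi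
  simp only [mem_Iio, mem_Ioi] at hx hx' hy hy'
  obtain ⟨n, hn⟩ := hlower.exists_convPow hupper (a := 2 * a) (by linarith) (by linarith)
  refine ⟨2 * n, ?_⟩
  have hpair : convPow ρ 2 = ρ ∗ ρ := by rw [convPow, convPow_one]
  rw [convPow_mul, hpair, Nat.cast_mul, Nat.cast_ofNat, mul_right_comm, mul_comm (2 * a)]
  exact hn

end MinorizedNear

section LowerBound

open Metric

lemma pow_smul_restrict_ball_le_convPow {μ : Measure ℝ} [SFinite μ] {x r : ℝ} {c d : ℝ≥0∞}
    (hμ : c • volume.restrict (ball x (2 * r)) ≤ μ) (hr : 0 < r) (hc : d ≤ c)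
    (hcr : d ≤ c * ENNReal.ofReal r) {m : ℕ} (hm : m ≠ 0) :
    d ^ m • volume.restrict (ball (m * x) ((m + 1) * r)) ≤ convPow μ m := by
  induction m, Nat.one_le_iff_ne_zero.2 hm using Nat.le_induction with
  | base =>
    rw [convPow_one]
    refine smul_restrict_mono (by simpa using hc) (subset_of_eq ?_) hμ
    congr 1 <;> push_cast <;> ring
  | succ m hle ih =>
    have : (1 : ℝ) ≤ m := by exact_mod_cast hle
    rw [convPow]
    refine smul_restrict_mono ?_ (subset_of_eq ?_) (smul_restrict_ball_le_conv (s := r) hμ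
      (ih (by lia)) (by linarith) (by nlinarith))
    · rw [pow_succ', mul_right_comm]
      gcongr
    · congr 1 <;> push_cast <;> ring

lemma exists_exp_smul_restrict_ball_le_convPow {ρ : Measure ℝ} [IsProbabilityMeasure ρ]
    (hρ : ρ ≪ volume) (hint : Integrable id ρ) :
    ∃ k : ℕ, ∃ L ≥ (0 : ℝ), ∃ η > (0 : ℝ), ∀ m : ℕ, m ≠ 0 →
      ENNReal.ofReal (exp (-(L * m))) •
        volume.restrict (ball ((k * m : ℕ) * ∫ x, x ∂ρ) (m * η)) ≤ convPow ρ (k * m) := by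
  obtain ⟨k, c, hc, r, hr, hle⟩ := exists_isMinorizedNear_convPow_mean hρ hint
  set d := min 1 (min c (c * ENNReal.ofReal (r / 2))) with hd
  have hd₀ : d ≠ 0 := (lt_min one_pos (lt_min hc.bot_lt
    (ENNReal.mul_pos hc (ENNReal.ofReal_pos.2 (half_pos hr)).ne'))).ne'
  have hd₁ : d.toReal ≤ 1 := ENNReal.toReal_le_of_le_ofReal one_pos.le (by simp [hd])
  have hd_top : d ≠ ∞ := ne_top_of_le_ne_top ENNReal.one_ne_top (min_le_left _ _)
  have hd_pos : 0 < d.toReal := ENNReal.toReal_pos hd₀ hd_top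
  refine ⟨k, -log d.toReal, neg_nonneg.2 (log_nonpos hd_pos.le hd₁), r / 2, half_pos hr,
    fun m hm => ?_⟩
  rw [convPow_mul, Nat.cast_mul, mul_comm (k : ℝ), mul_assoc]
  refine smul_restrict_mono (le_of_eq ?_) (ball_subset_ball ?_)
    (pow_smul_restrict_ball_le_convPow (d := d) (r := r / 2)
      (by rwa [mul_div_cancel₀ _ two_ne_zero])
      (half_pos hr) ((min_le_right _ _).trans (min_le_left _ _))
      ((min_le_right _ _).trans (min_le_right _ _)) hm)
  · rw [neg_mul, neg_neg, mul_comm, exp_nat_mul, exp_log hd_pos,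
      ENNReal.ofReal_pow hd_pos.le, ENNReal.ofReal_toReal hd_top]
  · linarith

lemma mul_lintegral_ball_mul_le_lintegral_conv {μ ν : Measure ℝ} [SFinite μ] [SFinite ν]
    {c : ℝ≥0∞} {y z r s R : ℝ} (hμ : c • volume.restrict (ball y r) ≤ μ) (hsR : s + R ≤ r)
    {φ : ℝ → ℝ≥0∞} (hφ : Measurable φ) :
    c * (∫⁻ t in ball 0 R, φ t) * ν (ball (z - y) s) ≤ ∫⁻ t, φ (z - t) ∂(μ ∗ ν) := by
  have hinner : ∀ w ∈ ball (z - y) s,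
      c * ∫⁻ t in ball 0 R, φ t ≤ ∫⁻ x, φ (z - (w + x)) ∂μ := fun w hw => by
    refine le_trans ?_ (lintegral_mono' hμ le_rfl)
    rw [lintegral_smul_measure, smul_eq_mul]
    refine mul_le_mul_right ?_ c
    rw [← (Measure.measurePreserving_sub_left volume (z - w)).setLIntegral_comp_preimage
      measurableSet_ball hφ]
    simp only [sub_sub]
    refine lintegral_mono_set fun x hx => ?_
    simp only [mem_preimage, mem_ball, Real.dist_eq, abs_lt] at hx hw ⊢
    constructor <;> linarith [hx.1, hx.2, hw.1, hw.2]
  calc c * (∫⁻ t in ball 0 R, φ t) * ν (ball (z - y) s)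
      = ∫⁻ _ in ball (z - y) s, c * (∫⁻ t in ball 0 R, φ t) ∂ν := by rw [setLIntegral_const]
    _ ≤ ∫⁻ w in ball (z - y) s, ∫⁻ x, φ (z - (w + x)) ∂μ ∂ν :=
        setLIntegral_mono' measurableSet_ball hinner
    _ ≤ ∫⁻ w, ∫⁻ x, φ (z - (w + x)) ∂μ ∂ν := setLIntegral_le_lintegral _ _
    _ = ∫⁻ t, φ (z - t) ∂(μ ∗ ν) := by
        rw [Measure.conv_comm, Measure.lintegral_conv (by fun_prop)]

lemma exists_lintegral_ball_ne_zero {φ : ℝ → ℝ≥0∞} (hφ : ∫⁻ t, φ t ≠ 0) :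
    ∃ R, ∫⁻ t in ball 0 R, φ t ≠ 0 := by
  by_contra! hnull
  refine hφ ?_
  rw [← setLIntegral_univ, ← iUnion_ball_nat (0 : ℝ)]
  exact le_antisymm ((lintegral_iUnion_le _ _).trans (by simp [hnull])) zero_le

lemma exists_natCast_linear_bounds (k : ℕ) {L ε : ℝ} (hL : 0 ≤ L) (hε : 0 < ε) :
    ∃ α > (0 : ℝ), ∃ m : ℕ → ℕ, ∀ᶠ n : ℕ in atTop,
      α * n ≤ m n ∧ k * m n ≤ n / 2 ∧ L * m n ≤ ε * n := by
  have hsmall : ∀ c : ℝ, ∀ δ > 0, ∀ᶠ θ in 𝓝[>] (0 : ℝ), c * θ ≤ δ := fun c δ hδ =>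
    ((Continuous.tendsto' (by fun_prop) 0 0 (by simp)).mono_left nhdsWithin_le_nhds).eventually
      (Iic_mem_nhds hδ)
  obtain ⟨θ, hk, hLθ, hθ⟩ := ((hsmall k 2⁻¹ (by norm_num)).and ((hsmall L ε hε).and
    self_mem_nhdsWithin)).exists
  have hθ : 0 < θ := hθ
  refine ⟨θ / 2, by positivity, fun n => ⌊θ * n⌋₊, ?_⟩
  filter_upwards [(tendsto_natCast_atTop_atTop.const_mul_atTop hθ).eventually_ge_atTop 2] with n hn
  have hfloor : (⌊θ * n⌋₊ : ℝ) ≤ θ * n := Nat.floor_le (by positivity)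
  refine ⟨by linarith [Nat.lt_floor_add_one (θ * n)], ?_, ?_⟩
  · rw [Nat.le_div_iff_mul_le two_pos, ← Nat.cast_le (α := ℝ)]
    push_cast
    nlinarith [mul_le_mul_of_nonneg_left hfloor k.cast_nonneg,
      mul_le_mul_of_nonneg_right hk n.cast_nonneg]
  · calc L * ⌊θ * n⌋₊ ≤ L * θ * n := by rw [mul_assoc]; gcongr
      _ ≤ ε * n := by gcongr

lemma mul_lintegral_ball_mul_le_lintegral_convPow {ρ : Measure ℝ} [SFinite ρ] {c : ℝ≥0∞}
    {a b r s R : ℝ} {p q : ℕ} (hq : c • volume.restrict (ball (q * a) r) ≤ convPow ρ q)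
    (hr : s + |b| + R ≤ r) {φ : ℝ → ℝ≥0∞} (hφ : Measurable φ) :
    c * (∫⁻ t in ball 0 R, φ t) * convPow ρ p (ball (p * a) s) ≤
      ∫⁻ t, φ ((q + p : ℕ) * a + b - t) ∂convPow ρ (q + p) := by
  rw [convPow_add]
  refine le_trans ?_ (mul_lintegral_ball_mul_le_lintegral_conv hq hr hφ)
  gcongr
  refine ball_subset_ball' ?_
  have hcenter : p * a - ((q + p : ℕ) * a + b - q * a) = -b := by
    push_cast
    ring
  rw [Real.dist_eq, hcenter, abs_neg]

lemma eventually_ofReal_exp_neg_mul_le {ε : ℝ} (hε : 0 < ε) {K : ℝ≥0∞} (hK : K ≠ 0) :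
    ∀ᶠ n : ℕ in atTop, ENNReal.ofReal (exp (-(ε * n))) ≤ K := by
  have hlim : Tendsto (fun n : ℕ => ENNReal.ofReal (exp (-(ε * n)))) atTop (𝓝 0) := by
    rw [← ENNReal.ofReal_zero]
    exact ENNReal.tendsto_ofReal (tendsto_exp_neg_atTop_nhds_zero.comp
      (tendsto_natCast_atTop_atTop.const_mul_atTop hε))
  exact hlim.eventually (Iic_mem_nhds (pos_iff_ne_zero.2 hK))

/-- Of the `n` summands, a small proportion `k * m n` supplies a density on a window of width of
order `n`, at an exponential cost, and the law of large numbers puts the sum of the remaining `p n`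
inside that window. -/
lemma eventually_exp_le_lintegral_convPow {ρ : Measure ℝ} [IsProbabilityMeasure ρ]
    (hρ : ρ ≪ volume) (hint : Integrable id ρ) {φ : ℝ → ℝ≥0∞} (hφ : Measurable φ)
    (hφ₀ : ∫⁻ t, φ t ≠ 0) (b : ℝ) {ε : ℝ} (hε : 0 < ε) :
    ∀ᶠ n : ℕ in atTop, ENNReal.ofReal (exp (-(ε * n))) ≤
      ∫⁻ s, φ (n * ∫ x, x ∂ρ + b - s) ∂convPow ρ n := by
  obtain ⟨k, L, hL, η, hη, hfloor⟩ := exists_exp_smul_restrict_ball_le_convPow hρ hint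
  obtain ⟨R, hR⟩ := exists_lintegral_ball_ne_zero hφ₀
  obtain ⟨α, hα, m, hm⟩ := exists_natCast_linear_bounds k hL (half_pos hε)
  set a := ∫ x, x ∂ρ
  set p : ℕ → ℕ := fun n => n - k * m n
  have hp : Tendsto p atTop atTop := tendsto_atTop_mono' _ (hm.mono fun n hn => by
    change n / 2 ≤ n - k * m n
    lia) (Nat.tendsto_div_const_atTop two_ne_zero)
  have hlln : ∀ᶠ n in atTop, 2⁻¹ ≤ convPow ρ (p n) (ball (p n * a) (p n * (η * α / 2))) :=
    ((tendsto_convPow_ball hint (by positivity)).comp hp).eventually (Ici_mem_nhds (by norm_num))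
  filter_upwards [hm, hlln, eventually_ofReal_exp_neg_mul_le (half_pos hε)
    (mul_ne_zero hR (by simp : (2⁻¹ : ℝ≥0∞) ≠ 0)), eventually_gt_atTop 0,
    (tendsto_natCast_atTop_atTop.const_mul_atTop
      (by positivity : 0 < η * α / 2)).eventually_ge_atTop (|b| + R)]
    with n ⟨hαm, hkm, hLm⟩ hball hexp hn₀ hbR
  have hm₀ : m n ≠ 0 := by
    have : (0 : ℝ) < m n := lt_of_lt_of_le (by positivity) hαm
    exact_mod_cast this.ne'
  have hsplit : k * m n + p n = n := Nat.add_sub_cancel' (by lia)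
  have hpn : (p n : ℝ) ≤ n := by exact_mod_cast Nat.sub_le _ _
  have hwindow : p n * (η * α / 2) + |b| + R ≤ m n * η := by
    nlinarith [mul_le_mul_of_nonneg_left hpn (by positivity : 0 ≤ η * α / 2)]
  calc ENNReal.ofReal (exp (-(ε * n)))
      = ENNReal.ofReal (exp (-(ε / 2 * n))) * ENNReal.ofReal (exp (-(ε / 2 * n))) := by
        rw [← ENNReal.ofReal_mul (by positivity), ← exp_add]
        ring_nf
    _ ≤ ENNReal.ofReal (exp (-(L * m n))) * ((∫⁻ t in ball 0 R, φ t) *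
          convPow ρ (p n) (ball (p n * a) (p n * (η * α / 2)))) := by
        gcongr
        exact hexp.trans (by gcongr)
    _ ≤ ∫⁻ s, φ (n * a + b - s) ∂convPow ρ n := by
        have h := mul_lintegral_ball_mul_le_lintegral_convPow (p := p n) (hfloor _ hm₀) hwindow hφ
        rwa [hsplit, mul_assoc] at h

end LowerBound

section Slicing

lemma lintegral_mul_self_comp_sq (k : ℝ → ℝ≥0∞) (c : ℝ) :
    ∫⁻ r in Ioi (0 : ℝ), ENNReal.ofReal r * k r = 2⁻¹ * ∫⁻ u in Ioi c, k √(u - c) := by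
  have himg : (fun r : ℝ => r ^ 2 + c) '' Ioi 0 = Ioi c := by
    ext u
    refine ⟨?_, fun hu => ⟨√(u - c), Real.sqrt_pos.2 (sub_pos.2 hu), ?_⟩⟩
    · rintro ⟨r, hr, rfl⟩
      exact lt_add_of_pos_left c (pow_pos hr 2)
    · simp only [Real.sq_sqrt (sub_pos.2 hu).le, sub_add_cancel]
  have hinj : InjOn (fun r : ℝ => r ^ 2 + c) (Ioi 0) := fun a ha b hb hab =>
    (pow_left_inj₀ (le_of_lt ha) (le_of_lt hb) two_ne_zero).1 (add_right_cancel hab)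
  rw [← himg, lintegral_image_eq_lintegral_abs_deriv_mul (f' := fun r => 2 * r) measurableSet_Ioi
    (fun x _ => by simpa using ((hasDerivAt_pow 2 x).add_const c).hasDerivWithinAt) hinj,
    ← lintegral_const_mul' _ _ (by simp)]
  refine setLIntegral_congr_fun measurableSet_Ioi fun r (hr : 0 < r) => ?_
  simp only [add_sub_cancel_right, Real.sqrt_sq hr.le]
  rw [abs_of_pos (by positivity), ENNReal.ofReal_mul two_pos.le, ENNReal.ofReal_ofNat, mul_assoc,
    ← mul_assoc, ENNReal.inv_mul_cancel two_ne_zero ENNReal.ofNat_ne_top, one_mul]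

/-- Polar coordinates in the plane, with the shifted squared radius `u = r ^ 2 + c` as variable. -/
lemma lintegral_plane {G : ℝ × ℝ → ℝ≥0∞} (hG : Measurable G) (c : ℝ) :
    ∫⁻ p, G p = 2⁻¹ * ∫⁻ u in Ioi c, ∫⁻ θ in Ioo (-π) π,
      G (√(u - c) * cos θ, √(u - c) * sin θ) := by
  rw [← lintegral_comp_polarCoord_symm, polarCoord_target, Measure.volume_eq_prod,
    ← Measure.prod_restrict, lintegral_prod]
  · rw [← lintegral_mul_self_comp_sq (fun r => ∫⁻ θ in Ioo (-π) π, G (r * cos θ, r * sin θ)) c]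
    refine lintegral_congr fun r => ?_
    rw [← lintegral_const_mul' _ _ (by simp)]
    simp [polarCoord_symm_apply]
  · simp only [polarCoord_symm_apply, smul_eq_mul]
    fun_prop

variable {n : ℕ}

lemma lintegral_pi_succ {G : (Fin (n + 1) → ℝ) → ℝ≥0∞} (hG : Measurable G) :
    ∫⁻ v, G v = ∫⁻ w, ∫⁻ a, G (Fin.cons a w) := by
  have h := (volume_preserving_piFinSuccAbove (fun _ : Fin (n + 1) => ℝ) 0).symm
  rw [← h.lintegral_comp hG, Measure.volume_eq_prod, lintegral_prod_symm]
  · simp [MeasurableEquiv.piFinSuccAbove_symm_apply, Fin.insertNthEquiv]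
  · exact (hG.comp (MeasurableEquiv.measurable _)).aemeasurable

@[fun_prop]
lemma measurable_cons {α : Type*} [MeasurableSpace α] {a : α → ℝ} {w : α → Fin n → ℝ}
    (ha : Measurable a) (hw : Measurable w) :
    Measurable fun x => (Fin.cons (a x) (w x) : Fin (n + 1) → ℝ) :=
  measurable_pi_lambda _ (Fin.cases (by simpa using ha) fun j => by
    simpa using measurable_pi_iff.1 hw j)

lemma lintegral_pi_succ_succ {G : (Fin (n + 2) → ℝ) → ℝ≥0∞} (hG : Measurable G) :
    ∫⁻ v, G v = ∫⁻ w, ∫⁻ p : ℝ × ℝ, G (Fin.cons p.1 (Fin.cons p.2 w)) := by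
  rw [lintegral_pi_succ hG, lintegral_pi_succ (by fun_prop)]
  refine lintegral_congr fun w => ?_
  rw [Measure.volume_eq_prod, lintegral_prod_symm]
  fun_prop

/-- The point of the sphere of squared radius `s` lying over `w`, at angle `θ` in the plane of the
first two coordinates; meaningful when `∑ i, w i ^ 2 ≤ s`. -/
def sphereLift (s θ : ℝ) (w : Fin n → ℝ) : Fin (n + 2) → ℝ :=
  Fin.cons (√(s - ∑ i, w i ^ 2) * cos θ) (Fin.cons (√(s - ∑ i, w i ^ 2) * sin θ) w)

@[fun_prop]
lemma measurable_sphereLift {α : Type*} [MeasurableSpace α] {s θ : α → ℝ} {w : α → Fin n → ℝ}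
    (hs : Measurable s) (hθ : Measurable θ) (hw : Measurable w) :
    Measurable fun x => sphereLift (s x) (θ x) (w x) := by
  unfold sphereLift
  fun_prop

lemma sum_sq_sphereLift {s : ℝ} (θ : ℝ) {w : Fin n → ℝ} (h : ∑ i, w i ^ 2 ≤ s) :
    ∑ i, sphereLift s θ w i ^ 2 = s := by
  simp only [sphereLift, Fin.sum_univ_succ, Fin.cons_zero, Fin.cons_succ, mul_pow,
    Real.sq_sqrt (sub_nonneg.2 h)]
  linear_combination (s - ∑ i, w i ^ 2) * Real.sin_sq_add_cos_sq θ

lemma smul_sphereLift {c : ℝ} (hc : 0 ≤ c) (s θ : ℝ) (w : Fin n → ℝ) :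
    c • sphereLift s θ w = sphereLift (c ^ 2 * s) θ (c • w) := by
  have h : √(c ^ 2 * s - ∑ i, (c * w i) ^ 2) = c * √(s - ∑ i, w i ^ 2) := by
    rw [← Real.sqrt_sq hc, ← Real.sqrt_mul (sq_nonneg _), Real.sqrt_sq hc]
    simp_rw [mul_pow, ← Finset.mul_sum, mul_sub]
  ext i
  refine Fin.cases ?_ (Fin.cases ?_ fun k => ?_) i
  · simp [sphereLift, h, mul_assoc]
  · simp [sphereLift, h, mul_assoc]
  · simp [sphereLift]

/-- The measure on the sphere of squared radius `s` in `ℝ^(n+2)` that projects to Lebesgue measure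
on a ball of `ℝ^n`, with uniform angle in the two remaining coordinates. -/
def liftMeasure (n : ℕ) (s : ℝ) : Measure (Fin (n + 2) → ℝ) :=
  ((volume.restrict {w : Fin n → ℝ | ∑ i, w i ^ 2 < s}).prod (volume.restrict (Ioo (-π) π))).map
    fun q => sphereLift s q.2 q.1

lemma measurableSet_sum_sq_lt (s : ℝ) : MeasurableSet {w : Fin n → ℝ | ∑ i, w i ^ 2 < s} :=
  measurableSet_lt (by fun_prop) (by fun_prop)

lemma lintegral_liftMeasure (s : ℝ) {F : (Fin (n + 2) → ℝ) → ℝ≥0∞} (hF : Measurable F) :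
    ∫⁻ v, F v ∂liftMeasure n s =
      ∫⁻ w in {w : Fin n → ℝ | ∑ i, w i ^ 2 < s}, ∫⁻ θ in Ioo (-π) π, F (sphereLift s θ w) := by
  rw [liftMeasure, lintegral_map hF (by fun_prop), lintegral_prod _ (by fun_prop)]

lemma ae_sum_sq_eq_liftMeasure (s : ℝ) : ∀ᵐ v ∂liftMeasure n s, ∑ i, v i ^ 2 = s := by
  rw [liftMeasure, ae_map_iff (by fun_prop) (measurableSet_eq_fun (by fun_prop) (by fun_prop))]
  filter_upwards [Measure.quasiMeasurePreserving_fst.ae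
    (ae_restrict_mem (measurableSet_sum_sq_lt s))] with q hq
  exact sum_sq_sphereLift _ (le_of_lt hq)

lemma lintegral_eq_lintegral_liftMeasure {G : (Fin (n + 2) → ℝ) → ℝ≥0∞} (hG : Measurable G) :
    ∫⁻ v, G v = 2⁻¹ * ∫⁻ u in Ioi 0, ∫⁻ v, G v ∂liftMeasure n u := by
  have hplane : ∀ w : Fin n → ℝ, ∫⁻ p : ℝ × ℝ, G (Fin.cons p.1 (Fin.cons p.2 w)) =
      2⁻¹ * ∫⁻ u in Ioi 0, (Ioi (∑ i, w i ^ 2)).indicator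
        (fun u => ∫⁻ θ in Ioo (-π) π, G (sphereLift u θ w)) u := fun w => by
    rw [lintegral_plane (by fun_prop) (∑ i, w i ^ 2), setLIntegral_indicator measurableSet_Ioi,
      inter_eq_left.2 (Ioi_subset_Ioi (Finset.sum_nonneg fun i _ => sq_nonneg (w i)))]
    rfl
  have hmeas : Measurable fun q : (Fin n → ℝ) × ℝ => (Ioi (∑ i, q.1 i ^ 2)).indicator
      (fun u => ∫⁻ θ in Ioo (-π) π, G (sphereLift u θ q.1)) q.2 :=
    Measurable.indicator (s := {q : (Fin n → ℝ) × ℝ | ∑ i, q.1 i ^ 2 < q.2})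
      (f := fun q => ∫⁻ θ in Ioo (-π) π, G (sphereLift q.2 θ q.1)) (by fun_prop)
      (measurableSet_lt (by fun_prop) (by fun_prop))
  rw [lintegral_pi_succ_succ hG]
  simp_rw [hplane]
  rw [lintegral_const_mul' _ _ (by simp), lintegral_lintegral_swap hmeas.aemeasurable]
  congr 2 with u
  rw [lintegral_liftMeasure u hG, ← lintegral_indicator (measurableSet_sum_sq_lt u)]
  rfl

lemma liftMeasure_sq_mul {c : ℝ} (hc : 0 < c) (s : ℝ) :
    liftMeasure n (c ^ 2 * s) = ENNReal.ofReal (c ^ n) • (liftMeasure n s).map (c • ·) := by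
  have hemb : MeasurableEmbedding fun w : Fin n → ℝ => c • w :=
    (Homeomorph.smulOfNeZero c hc.ne').measurableEmbedding
  have hvol : (volume : Measure (Fin n → ℝ)) = ENNReal.ofReal (c ^ n) • volume.map (c • ·) := by
    rw [Measure.map_addHaar_smul _ hc.ne', Module.finrank_fin_fun, abs_of_pos (by positivity),
      smul_smul, ← ENNReal.ofReal_mul (by positivity), mul_inv_cancel₀ (by positivity),
      ENNReal.ofReal_one, one_smul]
  refine Measure.ext_of_lintegral _ fun F hF => ?_
  rw [lintegral_liftMeasure _ hF, lintegral_smul_measure, lintegral_map hF (by fun_prop),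
    lintegral_liftMeasure _ (by fun_prop), hvol, Measure.restrict_smul, lintegral_smul_measure,
    hemb.restrict_map, hemb.lintegral_map, ← hvol]
  simp only [preimage_ofPred_eq, Pi.smul_apply, smul_eq_mul, mul_pow, ← Finset.mul_sum,
    mul_lt_mul_iff_right₀ (pow_pos hc 2), smul_sphereLift hc.le]

lemma lintegral_radial_projection {s : ℝ} (hs : 0 < s) {F : (Fin (n + 2) → ℝ) → ℝ≥0∞}
    (hF : Measurable F) {ψ : ℝ → ℝ≥0∞} (hψ : Measurable ψ) :
    ∫⁻ v : Fin (n + 2) → ℝ, ψ (∑ i, v i ^ 2) * F (√(s / ∑ i, v i ^ 2) • v) =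
      (2⁻¹ * ∫⁻ u in Ioi 0, ψ u * ENNReal.ofReal (√(u / s) ^ n)) *
        ∫⁻ v, F v ∂liftMeasure n s := by
  rw [lintegral_eq_lintegral_liftMeasure (by fun_prop), mul_assoc,
    ← lintegral_mul_const _ (by fun_prop)]
  congr 1
  refine setLIntegral_congr_fun measurableSet_Ioi fun u (hu : 0 < u) => ?_
  have hc : 0 < √(u / s) := Real.sqrt_pos.2 (by positivity)
  have hus : √(u / s) ^ 2 * s = u := by
    rw [Real.sq_sqrt (by positivity), div_mul_cancel₀ _ hs.ne']
  have hinv : √(s / u) * √(u / s) = 1 := by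
    rw [← inv_div u s, Real.sqrt_inv, inv_mul_cancel₀ hc.ne']
  calc ∫⁻ v, ψ (∑ i, v i ^ 2) * F (√(s / ∑ i, v i ^ 2) • v) ∂liftMeasure n u
      = ∫⁻ v, ψ u * F (√(s / u) • v) ∂liftMeasure n u := by
        refine lintegral_congr_ae ?_
        filter_upwards [ae_sum_sq_eq_liftMeasure u] with v hv
        rw [hv]
    _ = ψ u * ∫⁻ v, F (√(s / u) • v) ∂liftMeasure n (√(u / s) ^ 2 * s) := by
        rw [lintegral_const_mul _ (by fun_prop), hus]
    _ = ψ u * (ENNReal.ofReal (√(u / s) ^ n) * ∫⁻ v, F v ∂liftMeasure n s) := by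
        rw [liftMeasure_sq_mul hc, lintegral_smul_measure, smul_eq_mul,
          lintegral_map (by fun_prop) (by fun_prop)]
        simp only [smul_smul, hinv, one_smul]
    _ = ψ u * ENNReal.ofReal (√(u / s) ^ n) * ∫⁻ v, F v ∂liftMeasure n s := (mul_assoc _ _ _).symm

end Slicing

section UniformMeasure

lemma map_coe_toSphere {E : Type*} [NormedAddCommGroup E] [NormedSpace ℝ E] [MeasurableSpace E]
    [BorelSpace E] [FiniteDimensional ℝ E] [Nontrivial E] (μ : Measure E) [μ.IsAddHaarMeasure] :
    μ.toSphere.map (↑) =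
      Module.finrank ℝ E • (μ.restrict (Metric.ball 0 1)).map fun x => ‖x‖⁻¹ • x := by
  ext s hs
  have hm : Measurable fun x : E => ‖x‖⁻¹ • x := by fun_prop
  rw [Measure.map_apply measurable_subtype_coe hs, μ.toSphere_apply' (measurable_subtype_coe hs),
    Measure.smul_apply, nsmul_eq_mul, Measure.map_apply hm hs, Measure.restrict_apply (hm hs)]
  congr 1
  refine measure_congr ?_
  filter_upwards [compl_mem_ae_iff.2 (measure_singleton (0 : E))] with x (hx : x ≠ 0)
  have hx' : 0 < ‖x‖ := norm_pos_iff.2 hx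
  refine propext ⟨?_, fun ⟨hs, hball⟩ => ?_⟩
  · rintro ⟨r, ⟨hr₀, hr₁⟩, _, ⟨y, hy, rfl⟩, rfl⟩
    have hnorm : ‖r • (y : E)‖ = r := by
      rw [norm_smul, norm_eq_of_mem_sphere, mul_one, Real.norm_of_nonneg hr₀.le]
    refine ⟨?_, by simpa [hnorm] using hr₁⟩
    simpa only [mem_preimage, hnorm, inv_smul_smul₀ hr₀.ne'] using hy
  · exact ⟨‖x‖, ⟨hx', by simpa using hball⟩, ‖x‖⁻¹ • x,
      ⟨⟨‖x‖⁻¹ • x, by simp [norm_smul, hx'.ne']⟩, hs, rfl⟩, smul_inv_smul₀ hx'.ne' x⟩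

lemma measurable_dilate (N : ℕ) : Measurable (dilate N) := by
  unfold dilate
  fun_prop

@[fun_prop]
lemma measurable_ofLp_coe (N : ℕ) :
    Measurable fun v : Sphere N => (v : EuclideanSpace ℝ (Fin N)).ofLp :=
  (PiLp.volume_preserving_ofLp _).measurable.comp measurable_subtype_coe

instance isProbabilityMeasure_sigma (N : ℕ) [NeZero N] : IsProbabilityMeasure (sigma N) := by
  have : NeZero (volume : Measure (EuclideanSpace ℝ (Fin N))).toSphere :=
    ⟨Measure.toSphere_ne_zero _⟩
  have : IsProbabilityMeasure (((volume : Measure (EuclideanSpace ℝ (Fin N))).toSphere univ)⁻¹ •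
      (volume : Measure (EuclideanSpace ℝ (Fin N))).toSphere) := inferInstance
  exact Measure.isProbabilityMeasure_map (measurable_dilate _).aemeasurable

lemma lintegral_ball_radial_projection {n : ℕ} {s : ℝ} (hs : 0 < s)
    {F : (Fin (n + 2) → ℝ) → ℝ≥0∞} (hF : Measurable F) :
    ∫⁻ x : EuclideanSpace ℝ (Fin (n + 2)) in Metric.ball 0 1, F (√s • (‖x‖⁻¹ • x)).ofLp =
      (2⁻¹ * ∫⁻ u in Ioi 0, (Iio (1 : ℝ)).indicator 1 u * ENNReal.ofReal (√(u / s) ^ n)) *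
        ∫⁻ v, F v ∂liftMeasure n s := by
  have hψ : Measurable ((Iio (1 : ℝ)).indicator 1 : ℝ → ℝ≥0∞) :=
    measurable_one.indicator measurableSet_Iio
  rw [← lintegral_radial_projection hs hF hψ,
    ← (PiLp.volume_preserving_ofLp (Fin (n + 2))).lintegral_comp (by fun_prop),
    ← lintegral_indicator measurableSet_ball]
  refine lintegral_congr fun x => ?_
  have hnorm : ∑ i, x.ofLp i ^ 2 = ‖x‖ ^ 2 := by simp [EuclideanSpace.norm_sq_eq]
  rw [hnorm, Real.sqrt_div hs.le, Real.sqrt_sq (norm_nonneg _), div_eq_mul_inv, mul_smul]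
  by_cases hx : ‖x‖ < 1 <;> simp [indicator, hx]

lemma exists_lintegral_sigma_ofLp (n : ℕ) : ∃ κ : ℝ≥0∞, ∀ F : (Fin (n + 2) → ℝ) → ℝ≥0∞,
    Measurable F → ∫⁻ v : Sphere (n + 2), F (v : EuclideanSpace ℝ (Fin (n + 2))).ofLp
      ∂sigma (n + 2) = κ * ∫⁻ v, F v ∂liftMeasure n (n + 2) := by
  refine ⟨((volume : Measure (EuclideanSpace ℝ (Fin (n + 2)))).toSphere univ)⁻¹ * ((n + 2) *
    (2⁻¹ * ∫⁻ u in Ioi 0, (Iio (1 : ℝ)).indicator 1 u * ENNReal.ofReal (√(u / (n + 2)) ^ n))),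
    fun F hF => ?_⟩
  have hofLp : Measurable fun x : EuclideanSpace ℝ (Fin (n + 2)) => F (√(n + 2) • x).ofLp :=
    hF.comp ((PiLp.volume_preserving_ofLp _).measurable.comp (measurable_const_smul _))
  rw [sigma, lintegral_map (by fun_prop) (measurable_dilate _), lintegral_smul_measure]
  simp only [dilate, Nat.cast_add, Nat.cast_ofNat]
  rw [← lintegral_map hofLp measurable_subtype_coe, map_coe_toSphere, lintegral_smul_measure,
    lintegral_map hofLp (by fun_prop), lintegral_ball_radial_projection (by positivity) hF,
    finrank_euclideanSpace_fin, smul_eq_mul, nsmul_eq_mul]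
  simp only [Nat.cast_add, Nat.cast_ofNat, mul_assoc]

lemma map_ofLp_sigma (n : ℕ) :
    (sigma (n + 2)).map (fun v : Sphere (n + 2) => (v : EuclideanSpace ℝ (Fin (n + 2))).ofLp) =
      (liftMeasure n (n + 2) univ)⁻¹ • liftMeasure n (n + 2) := by
  obtain ⟨κ, hκ⟩ := exists_lintegral_sigma_ofLp n
  have hmass : 1 = κ * liftMeasure n (n + 2) univ := by simpa using hκ 1 measurable_one
  rw [← ENNReal.eq_inv_of_mul_eq_one_left hmass.symm]
  refine Measure.ext_of_lintegral _ fun F hF => ?_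
  rw [lintegral_map hF (by fun_prop), hκ F hF, lintegral_smul_measure, smul_eq_mul]

end UniformMeasure

section CircularAverage

/-- The law of `v ^ 2` when `v` has density `g`. -/
def sqLaw (g : ℝ → ℝ≥0∞) : Measure ℝ := (volume.withDensity g).map (· ^ 2)

/-- The integral of `g ⊗ g` over the circle of squared radius `u`, with respect to the angle. It is
twice the density of the law of `v ^ 2 + w ^ 2` when `v` and `w` are independent of density `g`. -/
def circ (g : ℝ → ℝ≥0∞) (u : ℝ) : ℝ≥0∞ :=
  if 0 < u then ∫⁻ θ in Ioo (-π) π, g (√u * cos θ) * g (√u * sin θ) else 0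

variable {g : ℝ → ℝ≥0∞}

@[fun_prop]
lemma measurable_circ (hg : Measurable g) : Measurable (circ g) := by
  unfold circ
  refine Measurable.ite (measurableSet_lt measurable_const measurable_id) ?_ measurable_const
  exact Measurable.lintegral_prod_right'
    (f := fun q : ℝ × ℝ => g (√q.1 * cos q.2) * g (√q.1 * sin q.2)) (by fun_prop)

lemma lintegral_sqLaw (hg : Measurable g) {φ : ℝ → ℝ≥0∞} (hφ : Measurable φ) :
    ∫⁻ s, φ s ∂sqLaw g = ∫⁻ x, g x * φ (x ^ 2) := by
  rw [sqLaw, lintegral_map hφ (by fun_prop),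
    lintegral_withDensity_eq_lintegral_mul _ hg (by fun_prop)]
  rfl

instance sFinite_sqLaw : SFinite (sqLaw g) := by unfold sqLaw; infer_instance

lemma lintegral_convPow_sqLaw (hg : Measurable g) (n : ℕ) {φ : ℝ → ℝ≥0∞} (hφ : Measurable φ) :
    ∫⁻ s, φ s ∂convPow (sqLaw g) n = ∫⁻ w : Fin n → ℝ, (∏ i, g (w i)) * φ (∑ i, w i ^ 2) := by
  induction n generalizing φ with
  | zero =>
    rw [convPow, lintegral_dirac' _ hφ]
    simp [volume_pi]
  | succ n ih =>
    rw [convPow, Measure.lintegral_conv hφ, lintegral_sqLaw hg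
      (Measurable.lintegral_prod_right' (f := fun q : ℝ × ℝ => φ (q.1 + q.2)) (by fun_prop)),
      lintegral_pi_succ (by fun_prop), lintegral_lintegral_swap (by fun_prop)]
    refine lintegral_congr fun a => ?_
    rw [ih (by fun_prop), ← lintegral_const_mul _ (by fun_prop)]
    refine lintegral_congr fun w => ?_
    simp [Fin.prod_univ_succ, Fin.sum_univ_succ, mul_assoc]

lemma sqLaw_conv_sqLaw (hg : Measurable g) :
    sqLaw g ∗ sqLaw g = volume.withDensity fun u => 2⁻¹ * circ g u := by
  refine Measure.ext_of_lintegral _ fun φ hφ => ?_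
  rw [Measure.lintegral_conv hφ, lintegral_sqLaw hg
      (Measurable.lintegral_prod_right' (f := fun q : ℝ × ℝ => φ (q.1 + q.2)) (by fun_prop)),
    lintegral_withDensity_eq_lintegral_mul _ (by fun_prop) hφ]
  have hslice : ∀ x, g x * ∫⁻ t, φ (x ^ 2 + t) ∂sqLaw g =
      ∫⁻ y, g x * (g y * φ (x ^ 2 + y ^ 2)) := fun x => by
    rw [lintegral_sqLaw hg (by fun_prop), lintegral_const_mul _ (by fun_prop)]
  simp_rw [hslice]
  rw [← lintegral_prod (f := fun p : ℝ × ℝ => g p.1 * (g p.2 * φ (p.1 ^ 2 + p.2 ^ 2)))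
    (by fun_prop), ← Measure.volume_eq_prod, lintegral_plane (by fun_prop) 0]
  simp only [Pi.mul_apply, mul_assoc]
  rw [lintegral_const_mul _ (by fun_prop)]
  congr 1
  rw [← lintegral_indicator measurableSet_Ioi]
  refine lintegral_congr fun u => ?_
  by_cases hu : 0 < u
  · have : ∀ θ, (√u * cos θ) ^ 2 + (√u * sin θ) ^ 2 = u := fun θ => by
      have := Real.sin_sq_add_cos_sq θ
      rw [mul_pow, mul_pow, Real.sq_sqrt hu.le]
      linear_combination u * this
    simp only [circ, hu, if_true, indicator, mem_Ioi, sub_zero, this]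
    rw [← lintegral_mul_const _ (by fun_prop)]
    simp_rw [mul_assoc]
  · simp [circ, hu, indicator]

lemma sqLaw_univ : sqLaw g univ = ∫⁻ x, g x := by
  rw [sqLaw, Measure.map_apply (by fun_prop) .univ]
  simp

lemma lintegral_circ_ne_zero (hg : Measurable g) (hg₀ : ∫⁻ x, g x ≠ 0) : ∫⁻ u, circ g u ≠ 0 := by
  have hmass := congrArg (· univ) (sqLaw_conv_sqLaw hg)
  simp only [conv_univ, sqLaw_univ, withDensity_apply _ .univ, setLIntegral_univ,
    lintegral_const_mul _ (measurable_circ hg)] at hmass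
  exact right_ne_zero_of_mul (hmass ▸ mul_ne_zero hg₀ hg₀)

lemma map_sq_absolutelyContinuous :
    (volume : Measure ℝ).map (· ^ 2) ≪ (volume : Measure ℝ) := by
  refine Measure.AbsolutelyContinuous.mk fun B hB h0 => ?_
  rw [Measure.map_apply (by fun_prop) hB]
  have hd : DifferentiableOn ℝ Real.sqrt (B ∩ Ioi 0) := fun x hx =>
    (Real.hasDerivAt_sqrt (ne_of_gt hx.2)).differentiableAt.differentiableWithinAt
  have hB0 : volume (B ∩ Ioi 0) = 0 := measure_mono_null inter_subset_left h0
  have hslice := addHaar_image_eq_zero_of_differentiableOn_of_addHaar_eq_zero volume hd hB0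
  have h2 := addHaar_image_eq_zero_of_differentiableOn_of_addHaar_eq_zero volume hd.neg hB0
  refine measure_mono_null (t := {0} ∪ (Real.sqrt '' (B ∩ Ioi 0) ∪ (-Real.sqrt) '' (B ∩ Ioi 0)))
    (fun x hx => ?_) (measure_union_null (by simp) (measure_union_null hslice h2))
  rcases lt_trichotomy x 0 with h | h | h
  · exact Or.inr (Or.inr ⟨x ^ 2, ⟨hx, sq_pos_of_neg h⟩, by
      simp [Real.sqrt_sq_eq_abs, abs_of_neg h]⟩)
  · exact Or.inl h
  · exact Or.inr (Or.inl ⟨x ^ 2, ⟨hx, sq_pos_of_pos h⟩, Real.sqrt_sq h.le⟩)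

lemma sqLaw_absolutelyContinuous : sqLaw g ≪ volume :=
  ((withDensity_absolutelyContinuous _ _).map (by fun_prop)).trans map_sq_absolutelyContinuous

lemma sqLaw_mono {g' : ℝ → ℝ≥0∞} (h : g ≤ᵐ[volume] g') : sqLaw g ≤ sqLaw g' :=
  Measure.map_mono (withDensity_mono h) (by fun_prop)

lemma circ_const_le (C : ℝ≥0∞) (u : ℝ) : circ (fun _ => C) u ≤ ENNReal.ofReal (2 * π) * C ^ 2 := by
  unfold circ
  split_ifs
  · rw [setLIntegral_const, Real.volume_Ioo, mul_comm, sq]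
    apply le_of_eq
    congr 2
    ring
  · simp

lemma circ_le_of_ae_le (hg : Measurable g) {C : ℝ≥0∞} (hC : ∀ᵐ x, g x ≤ C) :
    ∀ᵐ u, circ g u ≤ ENNReal.ofReal (2 * π) * C ^ 2 := by
  refine ae_le_of_forall_setLIntegral_le_of_sigmaFinite (measurable_circ hg) fun s hs _ => ?_
  have h := conv_mono (sqLaw_mono hC) (sqLaw_mono hC) s
  rw [sqLaw_conv_sqLaw hg, sqLaw_conv_sqLaw measurable_const, withDensity_apply _ hs,
    withDensity_apply _ hs, lintegral_const_mul _ (measurable_circ hg),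
    lintegral_const_mul _ (measurable_circ measurable_const),
    ENNReal.mul_le_mul_iff_right (by simp) (by simp)] at h
  exact h.trans (lintegral_mono fun u => circ_const_le C u)

lemma lintegral_circ_sub_convPow_le (hg : Measurable g) {C : ℝ≥0∞} (hC : ∀ᵐ x, g x ≤ C) {n : ℕ}
    (hn : n ≠ 0) (a : ℝ) :
    ∫⁻ s, circ g (a - s) ∂convPow (sqLaw g) n ≤
      ENNReal.ofReal (2 * π) * C ^ 2 * (∫⁻ x, g x) ^ n := by
  have hcirc : ∀ᵐ s, circ g (a - s) ≤ ENNReal.ofReal (2 * π) * C ^ 2 :=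
    (Measure.measurePreserving_sub_left volume a).quasiMeasurePreserving.ae
      (circ_le_of_ae_le hg hC)
  refine (lintegral_mono_ae
    ((convPow_absolutelyContinuous sqLaw_absolutelyContinuous hn).ae_le hcirc)).trans ?_
  rw [lintegral_const, convPow_univ, sqLaw_univ]

end CircularAverage

section DensityMeasure

variable {f : ℝ → ℝ}

lemma integral_densityMeasure (hf : Measurable f) (hf₀ : ∀ v, 0 ≤ f v) (φ : ℝ → ℝ) :
    ∫ x, φ x ∂densityMeasure f = ∫ x, f x * φ x := by
  rw [densityMeasure, integral_withDensity_eq_integral_toReal_smul (by fun_prop)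
    (ae_of_all _ fun _ => ENNReal.ofReal_lt_top)]
  simp [ENNReal.toReal_ofReal (hf₀ _)]

lemma integrable_densityMeasure_iff (hf : Measurable f) (hf₀ : ∀ v, 0 ≤ f v) {φ : ℝ → ℝ} :
    Integrable φ (densityMeasure f) ↔ Integrable fun x => f x * φ x := by
  rw [densityMeasure, integrable_withDensity_iff_integrable_smul' (by fun_prop)
    (ae_of_all _ fun _ => ENNReal.ofReal_lt_top)]
  simp [ENNReal.toReal_ofReal (hf₀ _)]

/-- The bounded probability densities on the line with unit second moment. -/
structure IsKacDensity (f : ℝ → ℝ) : Prop where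
  measurable : Measurable f
  nonneg : ∀ v, 0 ≤ f v
  integral_eq_one : ∫ v, f v = 1
  integral_mul_sq : ∫ v, f v * v ^ 2 = 1
  memLp_top : MemLp f ∞

namespace IsKacDensity

lemma integrable (hf : IsKacDensity f) : Integrable f :=
  .of_integral_ne_zero (by simp [hf.integral_eq_one])

lemma lintegral_ofReal (hf : IsKacDensity f) : ∫⁻ v, ENNReal.ofReal (f v) = 1 := by
  rw [← ofReal_integral_eq_lintegral_ofReal hf.integrable (ae_of_all _ hf.nonneg),
    hf.integral_eq_one, ENNReal.ofReal_one]

lemma integrable_mul_sq (hf : IsKacDensity f) : Integrable fun v => f v * v ^ 2 :=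
  .of_integral_ne_zero (by simp [hf.integral_mul_sq])

lemma isProbabilityMeasure_densityMeasure (hf : IsKacDensity f) :
    IsProbabilityMeasure (densityMeasure f) :=
  ⟨by rw [densityMeasure, withDensity_apply _ .univ, setLIntegral_univ, hf.lintegral_ofReal]⟩

lemma isProbabilityMeasure_sqLaw (hf : IsKacDensity f) :
    IsProbabilityMeasure (sqLaw fun v => ENNReal.ofReal (f v)) :=
  ⟨by rw [sqLaw_univ, hf.lintegral_ofReal]⟩

lemma integrable_sqLaw (hf : IsKacDensity f) :
    Integrable id (sqLaw fun v => ENNReal.ofReal (f v)) :=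
  (integrable_map_measure (by fun_prop) (by fun_prop)).2
    ((integrable_densityMeasure_iff hf.measurable hf.nonneg).2 hf.integrable_mul_sq)

lemma integral_sqLaw (hf : IsKacDensity f) :
    ∫ x, x ∂sqLaw (fun v => ENNReal.ofReal (f v)) = 1 := by
  rw [sqLaw, integral_map (by fun_prop) measurable_id.aestronglyMeasurable (f := fun x => x)]
  exact (integral_densityMeasure hf.measurable hf.nonneg _).trans hf.integral_mul_sq

end IsKacDensity

end DensityMeasure

section PartitionFunction

variable {f : ℝ → ℝ}

@[fun_prop]
lemma measurable_tensor (hf : Measurable f) (N : ℕ) : Measurable (tensor f N) := by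
  unfold tensor
  fun_prop

lemma Z_add_two (hf : Measurable f) (n : ℕ) : Z f (n + 2) = (liftMeasure n (n + 2) univ)⁻¹ *
    ∫⁻ s, circ (fun x => ENNReal.ofReal (f x)) (n + 2 - s)
      ∂convPow (sqLaw fun x => ENNReal.ofReal (f x)) n := by
  have hprod : Measurable fun v : Fin (n + 2) → ℝ => ∏ j, ENNReal.ofReal (f (v j)) := by fun_prop
  rw [Z, lintegral_convPow_sqLaw (by fun_prop) _ (by fun_prop)]
  refine (lintegral_map hprod (measurable_ofLp_coe _)).symm.trans ?_
  rw [map_ofLp_sigma, lintegral_smul_measure, smul_eq_mul, lintegral_liftMeasure _ hprod,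
    ← lintegral_indicator (measurableSet_sum_sq_lt _)]
  congr 2 with w
  simp only [indicator, mem_ofPred_eq, circ, sub_pos]
  split_ifs
  · rw [← lintegral_const_mul _ (by fun_prop)]
    refine lintegral_congr fun θ => ?_
    simp only [sphereLift, Fin.prod_univ_succ, Fin.cons_zero, Fin.cons_succ]
    ring
  · simp

lemma Z_add_two_le (hf : Measurable f) {C : ℝ≥0∞} (hC : ∀ᵐ x, ENNReal.ofReal (f x) ≤ C) {n : ℕ}
    (hn : n ≠ 0) : Z f (n + 2) ≤ (liftMeasure n (n + 2) univ)⁻¹ *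
      (ENNReal.ofReal (2 * π) * C ^ 2 * (∫⁻ x, ENNReal.ofReal (f x)) ^ n) := by
  rw [Z_add_two hf]
  gcongr
  exact lintegral_circ_sub_convPow_le (by fun_prop) hC hn _

lemma IsKacDensity.eventually_le_Z_add_two (hf : IsKacDensity f) {ε : ℝ} (hε : 0 < ε) :
    ∀ᶠ n : ℕ in atTop, (liftMeasure n (n + 2) univ)⁻¹ * ENNReal.ofReal (exp (-(ε * n))) ≤
      Z f (n + 2) := by
  have := hf.isProbabilityMeasure_sqLaw
  have hm := hf.measurable.ennreal_ofReal
  filter_upwards [eventually_exp_le_lintegral_convPow sqLaw_absolutelyContinuous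
    hf.integrable_sqLaw (measurable_circ hm)
    (lintegral_circ_ne_zero hm (by simp [hf.lintegral_ofReal])) 2 hε] with n hn
  rw [hf.integral_sqLaw, mul_one] at hn
  rw [Z_add_two hf.measurable]
  gcongr

lemma eventually_mul_pow_le_exp {K I : ℝ≥0∞} (hK : K ≠ ∞) {c : ℝ}
    (hI : I < ENNReal.ofReal (exp c)) :
    ∃ ε > 0, ∀ᶠ n : ℕ in atTop,
      K * I ^ n ≤ ENNReal.ofReal (exp (c * (n + 2 : ℕ))) * ENNReal.ofReal (exp (-(ε * n))) := by
  obtain ⟨c', hI', hc' : c' < c⟩ := ((((ENNReal.continuous_ofReal.comp continuous_exp).tendsto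
    c).mono_left nhdsWithin_le_nhds).eventually (lt_mem_nhds hI) |>.and
      (self_mem_nhdsWithin (s := Iio c))).exists
  refine ⟨(c - c') / 2, by linarith, ?_⟩
  have hlim : Tendsto (fun n : ℕ => exp ((c - c') / 2 * n + 2 * c)) atTop atTop :=
    tendsto_exp_atTop.comp (tendsto_atTop_add_const_right _ _
      (tendsto_natCast_atTop_atTop.const_mul_atTop (by linarith)))
  filter_upwards [hlim.eventually_ge_atTop K.toReal] with n hn
  calc K * I ^ n
      ≤ ENNReal.ofReal (exp ((c - c') / 2 * n + 2 * c)) * ENNReal.ofReal (exp c') ^ n := by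
        gcongr
        · exact (ENNReal.le_ofReal_iff_toReal_le hK (exp_pos _).le).2 hn
        · exact hI'.le
    _ = _ := by
        rw [← ENNReal.ofReal_pow (exp_pos _).le, ← exp_nat_mul,
          ← ENNReal.ofReal_mul (exp_pos _).le, ← ENNReal.ofReal_mul (exp_pos _).le, ← exp_add,
          ← exp_add]
        push_cast
        ring_nf

/-- The exponential rate of `Z g` is governed by the mass of `g` alone: the dimensional constant is
the same for all densities and is removed by comparison with `Z f`. -/
lemma IsKacDensity.eventually_Z_le (hf : IsKacDensity f) {g : ℝ → ℝ} (hg : Measurable g)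
    (hbdd : MemLp g ∞) {c : ℝ} (hc : ∫⁻ x, ENNReal.ofReal (g x) < ENNReal.ofReal (exp c)) :
    ∀ᶠ N : ℕ in atTop, Z g N ≤ ENNReal.ofReal (exp (c * N)) * Z f N := by
  rw [← map_add_atTop_eq_nat 2, eventually_map]
  have hC : ∀ᵐ x, ENNReal.ofReal (g x) ≤ eLpNormEssSup g volume :=
    (ae_le_eLpNormEssSup (f := g)).mono fun x hx => (Real.ofReal_le_enorm _).trans hx
  have hCt : eLpNormEssSup g volume ≠ ∞ := by
    simpa only [eLpNorm_exponent_top] using hbdd.eLpNorm_ne_top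
  obtain ⟨ε, hε, hexp⟩ := eventually_mul_pow_le_exp (K := ENNReal.ofReal (2 * π) *
    eLpNormEssSup g volume ^ 2) (by finiteness) hc
  filter_upwards [hexp, hf.eventually_le_Z_add_two hε, eventually_ne_atTop 0] with n hexp hZ hn
  calc Z g (n + 2)
      ≤ (liftMeasure n (n + 2) univ)⁻¹ * (ENNReal.ofReal (exp (c * (n + 2 : ℕ))) *
          ENNReal.ofReal (exp (-(ε * n)))) := by
        refine (Z_add_two_le hg hC hn).trans ?_
        gcongr
    _ ≤ ENNReal.ofReal (exp (c * (n + 2 : ℕ))) * Z f (n + 2) := by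
        rw [mul_left_comm]
        gcongr

end PartitionFunction

section RelativeEntropy

variable {α : Type*} [MeasurableSpace α] {μ ν κ : Measure α}

lemma integrable_exp_sub_llr [SigmaFinite μ] [SigmaFinite ν] (hμν : μ ≪ ν) {Ψ : α → ℝ}
    (hΨ : Integrable (fun x => exp (Ψ x)) ν) :
    Integrable (fun x => exp (Ψ x - llr μ ν x)) μ := by
  have h := (integrable_withDensity_iff_integrable_smul' (Measure.measurable_rnDeriv ν μ)
    (Measure.rnDeriv_lt_top ν μ)).1 (hΨ.mono_measure (Measure.withDensity_rnDeriv_le ν μ))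
  refine h.congr ?_
  filter_upwards [exp_neg_llr hμν] with x hx
  rw [sub_eq_add_neg, exp_add, hx, smul_eq_mul, mul_comm]

lemma integrable_of_mem_integrableExpSet [SigmaFinite μ] [SigmaFinite ν] (hμν : μ ≪ ν)
    (hint : Integrable (llr μ ν) μ) {X : α → ℝ} (hX : AEStronglyMeasurable X μ) {t : ℝ}
    (ht : 0 < t) (hpos : t ∈ integrableExpSet X ν) (hneg : -t ∈ integrableExpSet X ν) :
    Integrable X μ := by
  have hexp := integrable_exp_sub_llr hμν (integrable_exp_mul_abs hpos hneg)
  refine ((hint.add hexp).const_mul t⁻¹).mono' hX (ae_of_all _ fun x => ?_)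
  rw [Pi.add_apply, norm_eq_abs, le_inv_mul_iff₀ ht]
  linarith [add_one_le_exp (t * |X x| - llr μ ν x)]

/-- The Donsker–Varadhan inequality, obtained as nonnegativity of the relative entropy of `μ` with
respect to the exponential tilt of `ν` by `t * X`. -/
lemma mul_integral_le_klDiv_add_cgf [IsProbabilityMeasure μ] [IsProbabilityMeasure ν]
    (hμν : klDiv μ ν ≠ ∞) {X : α → ℝ} (hX : Integrable X μ) {t : ℝ}
    (ht : t ∈ integrableExpSet X ν) :
    t * ∫ x, X x ∂μ ≤ (klDiv μ ν).toReal + cgf X ν t := by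
  obtain ⟨hac, hint⟩ := klDiv_ne_top_iff.1 hμν
  have htX := hX.const_mul t
  have := isProbabilityMeasure_tilted ht
  have hnonneg := integral_llr_add_sub_measure_univ_nonneg
    (hac.trans (absolutelyContinuous_tilted ht)) (integrable_llr_tilted_right hac htX hint ht)
  rw [integral_llr_tilted_right hac htX ht hint, probReal_univ, probReal_univ,
    integral_const_mul] at hnonneg
  rw [toReal_klDiv_of_measure_eq hac (by simp), cgf, mgf]
  linarith

lemma llr_ae_eq_add [SigmaFinite μ] [SigmaFinite ν] [SigmaFinite κ] (hμν : μ ≪ ν) (hνκ : ν ≪ κ) :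
    llr μ κ =ᵐ[μ] llr μ ν + llr ν κ := by
  have hμκ := hμν.trans hνκ
  filter_upwards [hμκ.ae_le (Measure.rnDeriv_mul_rnDeriv hμν (κ := κ)), Measure.rnDeriv_pos hμν,
    hμν.ae_le (Measure.rnDeriv_lt_top μ ν), hμν.ae_le (Measure.rnDeriv_pos hνκ),
    hμκ.ae_le (Measure.rnDeriv_lt_top ν κ)] with x hx h₁ h₁' h₂ h₂'
  simp only [llr, Pi.add_apply]
  rw [← hx, Pi.mul_apply, ENNReal.toReal_mul,
    log_mul (ENNReal.toReal_pos h₁.ne' h₁'.ne).ne' (ENNReal.toReal_pos h₂.ne' h₂'.ne).ne']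

lemma llr_withDensity_ae_eq [SigmaFinite κ] {h : α → ℝ≥0∞} (hh : Measurable h) :
    llr (κ.withDensity h) κ =ᵐ[κ] fun x => log (h x).toReal := by
  filter_upwards [Measure.rnDeriv_withDensity κ hh] with x hx
  rw [llr, hx]

lemma klDiv_eq_ofReal_klDiv_add_integral_llr [IsProbabilityMeasure μ] [IsProbabilityMeasure ν]
    [IsProbabilityMeasure κ] (hμν : klDiv μ ν ≠ ∞) (hνκ : ν ≪ κ) (hint : Integrable (llr ν κ) μ) :
    klDiv μ κ = ENNReal.ofReal ((klDiv μ ν).toReal + ∫ x, llr ν κ x ∂μ) := by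
  obtain ⟨hac, hllr⟩ := klDiv_ne_top_iff.1 hμν
  have hadd := llr_ae_eq_add hac hνκ
  rw [klDiv_of_ac_of_integrable (hac.trans hνκ) ((hllr.add hint).congr hadd.symm),
    integral_congr_ae hadd, integral_add' hllr hint, toReal_klDiv_of_measure_eq hac (by simp)]
  simp

end RelativeEntropy

section SlopeAtZero

lemma eventually_lt_of_mul_le {ι : Type*} {l : Filter ι} {a : ι → ℝ} {Λ : ℝ → ℝ} {m b : ℝ}
    (hΛ : HasDerivAt Λ m 0) (hΛ₀ : Λ 0 = 0)
    (h : ∀ᶠ t in 𝓝 0, ∀ c, Λ t < c → ∀ᶠ i in l, t * a i ≤ c) (hb : m < b) :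
    ∀ᶠ i in l, a i < b := by
  obtain ⟨b', hmb', hb'⟩ := exists_between hb
  have hslope : ∀ᶠ t in 𝓝[>] 0, t⁻¹ • (Λ (0 + t) - Λ 0) < b' :=
    hΛ.tendsto_slope_zero_right.eventually (gt_mem_nhds hmb')
  obtain ⟨t, ⟨hlt, ht⟩, ht₀ : 0 < t⟩ :=
    ((hslope.and (h.filter_mono nhdsWithin_le_nhds)).and self_mem_nhdsWithin).exists
  rw [zero_add, hΛ₀, sub_zero, smul_eq_mul, inv_mul_lt_iff₀ ht₀] at hlt
  filter_upwards [ht _ hlt] with i hi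
  exact (le_of_mul_le_mul_left hi ht₀).trans_lt hb'

/-- The mechanism of the Gärtner–Ellis theorem: dividing by small `t` of either sign bounds `a`
above and below by slopes of `Λ` at `0`. -/
lemma tendsto_of_mul_le_of_hasDerivAt {ι : Type*} {l : Filter ι} {a : ι → ℝ} {Λ : ℝ → ℝ} {m : ℝ}
    (hΛ : HasDerivAt Λ m 0) (hΛ₀ : Λ 0 = 0)
    (h : ∀ᶠ t in 𝓝 0, ∀ c, Λ t < c → ∀ᶠ i in l, t * a i ≤ c) : Tendsto a l (𝓝 m) := by
  refine tendsto_order.2 ⟨fun b hb => ?_, fun b hb => eventually_lt_of_mul_le hΛ hΛ₀ h hb⟩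
  have hneg : HasDerivAt (fun t => Λ (-t)) (-m) 0 := by
    simpa only [zero_sub] using
      HasDerivAt.comp_const_sub (0 : ℝ) 0 (by rwa [sub_zero])
  have hev := eventually_lt_of_mul_le (l := l) (a := fun i => -a i) hneg (by simpa using hΛ₀)
    (by simpa using (continuous_neg.tendsto' (0 : ℝ) 0 neg_zero).eventually h) (neg_lt_neg hb)
  exact hev.mono fun i hi => neg_lt_neg_iff.1 hi

end SlopeAtZero

section GaussianComparison

lemma gaussianPDFReal_zero_one (x : ℝ) :
    gaussianPDFReal 0 1 x = exp (-(log (2 * π) / 2) - x ^ 2 / 2) := by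
  rw [gaussianPDFReal_def, exp_sub, exp_neg, ← log_sqrt (by positivity), exp_log (by positivity),
    div_eq_mul_inv, ← exp_neg]
  simp [neg_div]

lemma isKacDensity_gaussianPDFReal : IsKacDensity (gaussianPDFReal 0 1) where
  measurable := measurable_gaussianPDFReal 0 1
  nonneg := gaussianPDFReal_nonneg 0 1
  integral_eq_one := integral_gaussianPDFReal_eq_one 0 one_ne_zero
  integral_mul_sq := by
    have h := variance_eq_sub (memLp_id_gaussianReal' (μ := 0) (v := 1) 2 (by simp))
    rw [variance_id_gaussianReal] at h
    simp only [Pi.pow_apply, id, integral_id_gaussianReal] at h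
    rw [integral_gaussianReal_eq_integral_smul one_ne_zero] at h
    simpa using h.symm
  memLp_top := by
    refine memLp_top_of_bound (stronglyMeasurable_gaussianPDFReal 0 1).aestronglyMeasurable
      (exp (-(log (2 * π) / 2))) (ae_of_all _ fun x => ?_)
    rw [norm_of_nonneg (gaussianPDFReal_nonneg 0 1 x), gaussianPDFReal_zero_one]
    exact exp_le_exp.2 (by linarith [sq_nonneg x])

lemma sum_sq_sphere {N : ℕ} (v : Sphere N) : ∑ j, (v : EuclideanSpace ℝ (Fin N)) j ^ 2 = N := by
  have h := EuclideanSpace.norm_sq_eq (v : EuclideanSpace ℝ (Fin N))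
  rw [norm_eq_of_mem_sphere v, sq_sqrt (Nat.cast_nonneg N)] at h
  simpa using h.symm

lemma Z_gaussianPDFReal (N : ℕ) [NeZero N] :
    Z (gaussianPDFReal 0 1) N = ENNReal.ofReal (exp (-((log (2 * π) + 1) / 2) * N)) := by
  have h : tensor (gaussianPDFReal 0 1) N =
      fun _ => ENNReal.ofReal (exp (-((log (2 * π) + 1) / 2) * N)) := by
    ext v
    simp_rw [tensor, gaussianPDFReal_zero_one]
    rw [← ENNReal.ofReal_prod_of_nonneg fun i _ => (exp_pos _).le, ← exp_sum,
      Finset.sum_sub_distrib, ← Finset.sum_div, sum_sq_sphere]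
    simp only [Finset.sum_const, Finset.card_univ, Fintype.card_fin, nsmul_eq_mul]
    congr 2
    ring
  rw [Z, h, lintegral_const, measure_univ, mul_one]

variable {f : ℝ → ℝ}

lemma IsKacDensity.lintegral_lt_ofReal_exp (hf : IsKacDensity f) {ε : ℝ} (hε : 0 < ε) :
    ∫⁻ x, ENNReal.ofReal (f x) < ENNReal.ofReal (exp ε) := by
  rw [hf.lintegral_ofReal, ENNReal.one_lt_ofReal]
  exact one_lt_exp_iff.2 hε

lemma IsKacDensity.eventually_Z_mem_Icc (hf : IsKacDensity f) {ε : ℝ} (hε : 0 < ε) :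
    ∀ᶠ N : ℕ in atTop, Z f N ∈ Icc
      (ENNReal.ofReal (exp ((-((log (2 * π) + 1) / 2) - ε) * N)))
      (ENNReal.ofReal (exp ((-((log (2 * π) + 1) / 2) + ε) * N))) := by
  have hγ := isKacDensity_gaussianPDFReal
  filter_upwards [hf.eventually_Z_le hγ.measurable hγ.memLp_top (hγ.lintegral_lt_ofReal_exp hε),
    hγ.eventually_Z_le hf.measurable hf.memLp_top (hf.lintegral_lt_ofReal_exp hε),
    eventually_ne_atTop 0] with N hlower hupper hN
  have : NeZero N := ⟨hN⟩
  rw [Z_gaussianPDFReal] at hlower hupper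
  constructor
  · rw [sub_mul, exp_sub, ENNReal.ofReal_div_of_pos (exp_pos _)]
    exact ENNReal.div_le_of_le_mul' hlower
  · rwa [add_mul, exp_add, mul_comm (exp _), ENNReal.ofReal_mul (exp_pos _).le]

lemma IsKacDensity.eventually_Z_ne_zero (hf : IsKacDensity f) : ∀ᶠ N in atTop, Z f N ≠ 0 :=
  (hf.eventually_Z_mem_Icc one_pos).mono fun _ hN =>
    ((ENNReal.ofReal_pos.2 (exp_pos _)).trans_le hN.1).ne'

lemma IsKacDensity.eventually_Z_ne_top (hf : IsKacDensity f) : ∀ᶠ N in atTop, Z f N ≠ ∞ :=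
  (hf.eventually_Z_mem_Icc one_pos).mono fun _ hN => ne_top_of_le_ne_top ENNReal.ofReal_ne_top hN.2

lemma IsKacDensity.tendsto_log_Z_div (hf : IsKacDensity f) :
    Tendsto (fun N : ℕ => log (Z f N).toReal / N) atTop (𝓝 (-((log (2 * π) + 1) / 2))) := by
  refine (nhds_basis_Icc_pos _).tendsto_right_iff.2 fun ε hε => ?_
  filter_upwards [hf.eventually_Z_mem_Icc hε, hf.eventually_Z_ne_top, hf.eventually_Z_ne_zero,
    eventually_gt_atTop 0] with N ⟨hlower, hupper⟩ htop h0 hN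
  have hN' : (0 : ℝ) < N := Nat.cast_pos.2 hN
  have hpos := ENNReal.toReal_pos h0 htop
  rw [mem_Icc, le_div_iff₀ hN', div_le_iff₀ hN', le_log_iff_exp_le hpos, log_le_iff_le_exp hpos]
  exact ⟨(ENNReal.ofReal_le_iff_le_toReal htop).1 hlower,
    ENNReal.toReal_le_of_le_ofReal (exp_pos _).le hupper⟩

end GaussianComparison

section PowerTilt

/-- The density `f ^ (1 + t)`, written so that it vanishes where `f` does. -/
def powerTilt (f : ℝ → ℝ) (t : ℝ) (x : ℝ) : ℝ := f x * exp (t * log (f x))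

/-- The cumulant generating function of `log f` under `f dv`. -/
def logCgf (f : ℝ → ℝ) : ℝ → ℝ := cgf (fun x => log (f x)) (densityMeasure f)

/-- The entropy integral `∫ f log f`, that is, minus the differential entropy of `f`. -/
def entropy (f : ℝ → ℝ) : ℝ := ∫ x, log (f x) ∂densityMeasure f

lemma mul_exp_mul_log_le {y t : ℝ} (hy : 0 ≤ y) (ht : |t| ≤ 1 / 2) :
    y * exp (t * log y) ≤ √y * (1 + y) := by
  rcases hy.eq_or_lt with rfl | hy
  · simp
  have habs : t * log y ≤ |log y / 2| := by
    rw [abs_div, abs_two, div_eq_inv_mul, ← one_div]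
    exact (le_abs_self _).trans (abs_mul t _ ▸ by gcongr)
  calc y * exp (t * log y)
      ≤ y * (exp (log y / 2) + exp (-(log y / 2))) := by
        gcongr
        exact (exp_le_exp.2 habs).trans (exp_abs_le _)
    _ = √y * √y * (√y + (√y)⁻¹) := by
        rw [exp_neg, exp_half, exp_log hy, mul_self_sqrt hy.le]
    _ = √y * (1 + y) := by
        rw [mul_assoc, mul_add, mul_self_sqrt hy.le, mul_inv_cancel₀ (sqrt_pos.2 hy).ne', add_comm]

variable {f : ℝ → ℝ}

@[fun_prop]
lemma measurable_powerTilt (hf : Measurable f) (t : ℝ) : Measurable (powerTilt f t) := by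
  unfold powerTilt
  fun_prop

lemma powerTilt_nonneg (hf₀ : ∀ v, 0 ≤ f v) (t x : ℝ) : 0 ≤ powerTilt f t x :=
  mul_nonneg (hf₀ x) (exp_pos _).le

namespace IsKacDensity

lemma exists_ae_le (hf : IsKacDensity f) : ∃ C : ℝ, ∀ᵐ x, f x ≤ C := by
  refine ⟨(eLpNorm f ∞).toReal, ?_⟩
  filter_upwards [ae_le_eLpNormEssSup (f := f)] with x hx
  rw [← eLpNorm_exponent_top] at hx
  simpa [norm_of_nonneg (hf.nonneg x)] using ENNReal.toReal_mono hf.memLp_top.eLpNorm_ne_top hx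

/-- By AM-GM, `2 * √f ≤ f * (1 + x ^ 2) + 1 / (1 + x ^ 2)`, and `f` has a second moment. -/
lemma integrable_sqrt (hf : IsKacDensity f) : Integrable fun x => √(f x) := by
  have hm := hf.measurable
  refine ((hf.integrable.add hf.integrable_mul_sq).add integrable_inv_one_add_sq).mono'
    (by fun_prop) (ae_of_all _ fun x => ?_)
  have hx : 0 < 1 + x ^ 2 := by positivity
  have hamgm : 2 * √(f x) ≤ f x * (1 + x ^ 2) + (1 + x ^ 2)⁻¹ := by
    have h := two_mul_le_add_sq (√(f x) * √(1 + x ^ 2)) (√(1 + x ^ 2))⁻¹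
    rwa [mul_pow, inv_pow, sq_sqrt (hf.nonneg x), sq_sqrt hx.le, mul_assoc, mul_assoc,
      mul_inv_cancel₀ (sqrt_pos.2 hx).ne', mul_one] at h
  rw [norm_of_nonneg (sqrt_nonneg _), Pi.add_apply, Pi.add_apply]
  linarith [sqrt_nonneg (f x)]

lemma integrable_powerTilt (hf : IsKacDensity f) {t : ℝ} (ht : |t| ≤ 1 / 2) :
    Integrable (powerTilt f t) := by
  obtain ⟨C, hC⟩ := hf.exists_ae_le
  refine (hf.integrable_sqrt.mul_const (1 + C)).mono'
    (measurable_powerTilt hf.measurable t).aestronglyMeasurable (hC.mono fun x hx => ?_)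
  rw [norm_of_nonneg (powerTilt_nonneg hf.nonneg t x)]
  refine (mul_exp_mul_log_le (hf.nonneg x) ht).trans ?_
  gcongr

lemma memLp_top_powerTilt (hf : IsKacDensity f) {t : ℝ} (ht : |t| ≤ 1 / 2) :
    MemLp (powerTilt f t) ∞ := by
  obtain ⟨C, hC⟩ := hf.exists_ae_le
  refine memLp_top_of_bound (measurable_powerTilt hf.measurable t).aestronglyMeasurable
    (√C * (1 + C)) (hC.mono fun x hx => ?_)
  have := hf.nonneg x
  rw [norm_of_nonneg (powerTilt_nonneg hf.nonneg t x)]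
  refine (mul_exp_mul_log_le (hf.nonneg x) ht).trans ?_
  gcongr

lemma mem_integrableExpSet_log (hf : IsKacDensity f) {t : ℝ} (ht : |t| ≤ 1 / 2) :
    t ∈ integrableExpSet (fun x => log (f x)) (densityMeasure f) :=
  (integrable_densityMeasure_iff hf.measurable hf.nonneg).2 (hf.integrable_powerTilt ht)

lemma zero_mem_interior_integrableExpSet_log (hf : IsKacDensity f) :
    0 ∈ interior (integrableExpSet (fun x => log (f x)) (densityMeasure f)) :=
  mem_interior_iff_mem_nhds.2 <| mem_of_superset (Icc_mem_nhds (by norm_num) (by norm_num))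
    fun _ ht => hf.mem_integrableExpSet_log (abs_le.2 ht)

lemma lintegral_powerTilt (hf : IsKacDensity f) {t : ℝ} (ht : |t| ≤ 1 / 2) :
    ∫⁻ x, ENNReal.ofReal (powerTilt f t x) = ENNReal.ofReal (exp (logCgf f t)) := by
  have := hf.isProbabilityMeasure_densityMeasure
  rw [← ofReal_integral_eq_lintegral_ofReal (hf.integrable_powerTilt ht)
    (ae_of_all _ (powerTilt_nonneg hf.nonneg t)), logCgf, exp_cgf (hf.mem_integrableExpSet_log ht),
    mgf, integral_densityMeasure hf.measurable hf.nonneg]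
  rfl

lemma hasDerivAt_logCgf (hf : IsKacDensity f) : HasDerivAt (logCgf f) (entropy f) 0 := by
  have := hf.isProbabilityMeasure_densityMeasure
  have h := hf.zero_mem_interior_integrableExpSet_log
  have hderiv := (analyticAt_cgf h).differentiableAt.hasDerivAt
  rwa [deriv_cgf_zero h, probReal_univ, div_one] at hderiv

lemma logCgf_zero (hf : IsKacDensity f) : logCgf f 0 = 0 :=
  have := hf.isProbabilityMeasure_densityMeasure
  cgf_zero

lemma integrable_log (hf : IsKacDensity f) :
    Integrable (fun x => log (f x)) (densityMeasure f) := by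
  simpa using integrable_pow_of_mem_interior_integrableExpSet
    hf.zero_mem_interior_integrableExpSet_log 1

end IsKacDensity

end PowerTilt

section GaussianEntropy

variable {f : ℝ → ℝ}

lemma llr_densityMeasure_gaussianReal (hf : Measurable f) (hf₀ : ∀ v, 0 ≤ f v)
    [SigmaFinite (densityMeasure f)] :
    llr (densityMeasure f) (gaussianReal 0 1) =ᵐ[densityMeasure f]
      fun x => log (f x) + (log (2 * π) / 2 + x ^ 2 / 2) := by
  have hγ : volume ≪ gaussianReal 0 1 := gaussianReal_absolutelyContinuous' 0 one_ne_zero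
  have hvol : densityMeasure f ≪ volume := withDensity_absolutelyContinuous _ _
  have hllr : llr (gaussianReal 0 1) volume =ᵐ[volume] _ :=
    gaussianReal_of_var_ne_zero 0 one_ne_zero ▸
      llr_withDensity_ae_eq (measurable_gaussianPDF 0 1)
  filter_upwards [llr_ae_eq_add (hvol.trans hγ) (gaussianReal_absolutelyContinuous 0 one_ne_zero),
    hvol.ae_le hllr, hvol.ae_le (llr_withDensity_ae_eq hf.ennreal_ofReal)] with x hadd hγx hfx
  rw [← densityMeasure, hadd, Pi.add_apply, hγx, toReal_gaussianPDF, gaussianPDFReal_zero_one,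
    log_exp, ENNReal.toReal_ofReal (hf₀ x)] at hfx
  linarith

lemma IsKacDensity.klDiv_gaussianReal (hf : IsKacDensity f) :
    klDiv (densityMeasure f) (gaussianReal 0 1) =
      ENNReal.ofReal (entropy f + (log (2 * π) + 1) / 2) := by
  have := hf.isProbabilityMeasure_densityMeasure
  have hac : densityMeasure f ≪ gaussianReal 0 1 :=
    (withDensity_absolutelyContinuous _ _).trans (gaussianReal_absolutelyContinuous' 0 one_ne_zero)
  have hllr := llr_densityMeasure_gaussianReal hf.measurable hf.nonneg
  have hsq : Integrable (fun x : ℝ => x ^ 2) (densityMeasure f) :=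
    (integrable_densityMeasure_iff hf.measurable hf.nonneg).2 hf.integrable_mul_sq
  have hquad : Integrable (fun x : ℝ => log (2 * π) / 2 + x ^ 2 / 2) (densityMeasure f) :=
    (integrable_const _).add (hsq.div_const 2)
  rw [klDiv_of_ac_of_integrable hac ((hf.integrable_log.add hquad).congr hllr.symm),
    integral_congr_ae hllr, integral_add hf.integrable_log hquad,
    integral_add (integrable_const _) (hsq.div_const 2), integral_div 2 fun x : ℝ => x ^ 2,
    integral_densityMeasure hf.measurable hf.nonneg (fun x => x ^ 2), hf.integral_mul_sq]
  simp only [integral_const, probReal_univ, smul_eq_mul, entropy, one_mul, add_sub_cancel_right]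
  ring_nf

end GaussianEntropy

section ConditionedProduct

/-- The logarithm `∑ⱼ log f(vⱼ)` of the tensor product `f^{⊗N}`, as an additive observable on the
sphere. -/
def logTensor (f : ℝ → ℝ) (N : ℕ) (v : Sphere N) : ℝ :=
  ∑ j, log (f ((v : EuclideanSpace ℝ (Fin N)) j))

variable {f : ℝ → ℝ} {N : ℕ}

@[fun_prop]
lemma measurable_logTensor (hf : Measurable f) (N : ℕ) : Measurable (logTensor f N) := by
  unfold logTensor
  fun_prop

lemma tensor_mul_exp_logTensor (hf₀ : ∀ v, 0 ≤ f v) (t : ℝ) (v : Sphere N) :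
    tensor f N v * ENNReal.ofReal (exp (t * logTensor f N v)) = tensor (powerTilt f t) N v := by
  rw [logTensor, Finset.mul_sum, exp_sum,
    ENNReal.ofReal_prod_of_nonneg fun _ _ => (exp_pos _).le, tensor, ← Finset.prod_mul_distrib]
  exact Finset.prod_congr rfl fun j _ => (ENNReal.ofReal_mul (hf₀ _)).symm

lemma log_toReal_tensor {v : Sphere N} (hv : tensor f N v ≠ 0) :
    log (tensor f N v).toReal = logTensor f N v := by
  have hpos : ∀ j, 0 < f ((v : EuclideanSpace ℝ (Fin N)) j) := fun j =>
    ENNReal.ofReal_pos.1 (pos_of_ne_zero (Finset.prod_ne_zero_iff.1 hv j (Finset.mem_univ j)))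
  rw [tensor, ENNReal.toReal_prod, log_prod fun j _ => (ENNReal.toReal_pos
    (ENNReal.ofReal_pos.2 (hpos j)).ne' ENNReal.ofReal_ne_top).ne']
  exact Finset.sum_congr rfl fun j _ => by rw [ENNReal.toReal_ofReal (hpos j).le]

lemma isProbabilityMeasure_conditioned (hf : Measurable f) (h₀ : Z f N ≠ 0) (htop : Z f N ≠ ∞) :
    IsProbabilityMeasure (conditioned f N) := by
  constructor
  simp_rw [conditioned, withDensity_apply _ .univ, setLIntegral_univ, div_eq_mul_inv]
  rw [lintegral_mul_const _ (measurable_tensor hf N)]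
  exact ENNReal.mul_inv_cancel h₀ htop

lemma lintegral_exp_logTensor_conditioned (hf : Measurable f) (hf₀ : ∀ v, 0 ≤ f v) (t : ℝ) :
    ∫⁻ v, ENNReal.ofReal (exp (t * logTensor f N v)) ∂conditioned f N =
      Z (powerTilt f t) N / Z f N := by
  rw [conditioned, lintegral_withDensity_eq_lintegral_mul _ (by fun_prop) (by fun_prop),
    Z.eq_def (powerTilt f t), div_eq_mul_inv, ← lintegral_mul_const _ (by fun_prop)]
  refine lintegral_congr fun v => ?_
  rw [← tensor_mul_exp_logTensor hf₀, Pi.mul_apply, div_eq_mul_inv, mul_right_comm]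

lemma llr_conditioned_sigma (hf : Measurable f) [NeZero N] (h₀ : Z f N ≠ 0) (htop : Z f N ≠ ∞) :
    llr (conditioned f N) (sigma N) =ᵐ[conditioned f N]
      fun v => logTensor f N v - log (Z f N).toReal := by
  have hm : Measurable fun v => tensor f N v / Z f N := by fun_prop
  have hpos : ∀ᵐ v ∂conditioned f N, tensor f N v ≠ 0 :=
    (ae_withDensity_iff hm).2 (ae_of_all _ fun v hv h => hv (by simp [h]))
  filter_upwards [hpos,
    (withDensity_absolutelyContinuous _ _).ae_le (llr_withDensity_ae_eq hm)] with v hv hllr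
  have hT : tensor f N v ≠ ∞ := ENNReal.prod_ne_top fun _ _ => ENNReal.ofReal_ne_top
  rw [conditioned, hllr, ENNReal.toReal_div, log_div (ENNReal.toReal_pos hv hT).ne'
    (ENNReal.toReal_pos h₀ htop).ne', log_toReal_tensor hv]

lemma klDiv_sigma (hf : Measurable f) [NeZero N] (h₀ : Z f N ≠ 0) (htop : Z f N ≠ ∞)
    {μ : Measure (Sphere N)} [IsProbabilityMeasure μ] (hμ : klDiv μ (conditioned f N) ≠ ∞)
    (hint : Integrable (logTensor f N) μ) :
    klDiv μ (sigma N) = ENNReal.ofReal ((klDiv μ (conditioned f N)).toReal +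
      (∫ v, logTensor f N v ∂μ - log (Z f N).toReal)) := by
  have := isProbabilityMeasure_conditioned hf h₀ htop
  have hllr := (klDiv_ne_top_iff.1 hμ).1.ae_eq (llr_conditioned_sigma hf h₀ htop)
  rw [klDiv_eq_ofReal_klDiv_add_integral_llr hμ (withDensity_absolutelyContinuous _ _)
    ((hint.sub (integrable_const _)).congr hllr.symm), integral_congr_ae hllr,
    integral_sub hint (integrable_const _), integral_const, probReal_univ, one_smul]

end ConditionedProduct

section LargeDeviations

variable {f : ℝ → ℝ}

lemma eventually_ne_top_of_tendsto_div_natCast {K : ℕ → ℝ≥0∞} {L : ℝ≥0∞} (hL : L ≠ ∞)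
    (h : Tendsto (fun N : ℕ => K N / (N : ℝ≥0∞)) atTop (𝓝 L)) : ∀ᶠ N in atTop, K N ≠ ∞ := by
  filter_upwards [h.eventually (gt_mem_nhds hL.lt_top)] with N hN htop
  simp [htop, ENNReal.top_div_of_ne_top (ENNReal.natCast_ne_top N)] at hN

lemma tendsto_toReal_div_natCast {K : ℕ → ℝ≥0∞} {L : ℝ≥0∞} (hL : L ≠ ∞)
    (h : Tendsto (fun N : ℕ => K N / (N : ℝ≥0∞)) atTop (𝓝 L)) :
    Tendsto (fun N : ℕ => (K N).toReal / N) atTop (𝓝 L.toReal) := by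
  simpa [Function.comp_def] using (ENNReal.tendsto_toReal hL).comp h

namespace IsKacDensity

lemma eventually_isProbabilityMeasure_conditioned (hf : IsKacDensity f) :
    ∀ᶠ N in atTop, IsProbabilityMeasure (conditioned f N) := by
  filter_upwards [hf.eventually_Z_ne_zero, hf.eventually_Z_ne_top] with N h₀ htop
    using isProbabilityMeasure_conditioned hf.measurable h₀ htop

lemma eventually_lintegral_exp_logTensor_le (hf : IsKacDensity f) {t : ℝ} (ht : |t| ≤ 1 / 2)
    {c : ℝ} (hc : logCgf f t < c) : ∀ᶠ N : ℕ in atTop,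
      ∫⁻ v, ENNReal.ofReal (exp (t * logTensor f N v)) ∂conditioned f N ≤
        ENNReal.ofReal (exp (c * N)) := by
  have hlt : ∫⁻ x, ENNReal.ofReal (powerTilt f t x) < ENNReal.ofReal (exp c) := by
    rw [hf.lintegral_powerTilt ht]
    exact (ENNReal.ofReal_lt_ofReal_iff (exp_pos c)).2 (exp_lt_exp.2 hc)
  filter_upwards [hf.eventually_Z_le (measurable_powerTilt hf.measurable t)
    (hf.memLp_top_powerTilt ht) hlt] with N hN
  rw [lintegral_exp_logTensor_conditioned hf.measurable hf.nonneg]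
  exact ENNReal.div_le_of_le_mul hN

lemma eventually_mem_integrableExpSet_logTensor (hf : IsKacDensity f) {t : ℝ} (ht : |t| ≤ 1 / 2) :
    ∀ᶠ N in atTop, t ∈ integrableExpSet (logTensor f N) (conditioned f N) := by
  have hm := hf.measurable
  filter_upwards [hf.eventually_lintegral_exp_logTensor_le ht (lt_add_one _)] with N hN
  refine ⟨by fun_prop, ?_⟩
  rw [hasFiniteIntegral_iff_ofReal (ae_of_all _ fun _ => (exp_pos _).le)]
  exact hN.trans_lt ENNReal.ofReal_lt_top

lemma eventually_cgf_logTensor_le (hf : IsKacDensity f) {t : ℝ} (ht : |t| ≤ 1 / 2) {c : ℝ}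
    (hc : logCgf f t < c) :
    ∀ᶠ N : ℕ in atTop, cgf (logTensor f N) (conditioned f N) t ≤ c * N := by
  filter_upwards [hf.eventually_lintegral_exp_logTensor_le ht hc,
    hf.eventually_mem_integrableExpSet_logTensor ht,
    hf.eventually_isProbabilityMeasure_conditioned] with N hN hmem _
  rw [cgf, log_le_iff_le_exp (mgf_pos hmem), mgf,
    integral_eq_lintegral_of_nonneg_ae (ae_of_all _ fun _ => (exp_pos _).le) hmem.1]
  exact ENNReal.toReal_le_of_le_ofReal (exp_pos _).le hN

variable {μ : ∀ N : ℕ, Measure (Sphere N)}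

lemma eventually_integrable_logTensor (hf : IsKacDensity f) [∀ N, IsProbabilityMeasure (μ N)]
    (hμ : ∀ᶠ N in atTop, klDiv (μ N) (conditioned f N) ≠ ∞) :
    ∀ᶠ N in atTop, Integrable (logTensor f N) (μ N) := by
  filter_upwards [hμ, hf.eventually_isProbabilityMeasure_conditioned,
    hf.eventually_mem_integrableExpSet_logTensor (t := 1 / 2) (by norm_num),
    hf.eventually_mem_integrableExpSet_logTensor (t := -(1 / 2)) (by norm_num)]
    with N hN _ hpos hneg
  obtain ⟨hac, hint⟩ := klDiv_ne_top_iff.1 hN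
  exact integrable_of_mem_integrableExpSet hac hint
    (measurable_logTensor hf.measurable N).aestronglyMeasurable (by norm_num) hpos hneg

lemma tendsto_integral_logTensor_div (hf : IsKacDensity f) [∀ N, IsProbabilityMeasure (μ N)]
    (hμ : Tendsto (fun N : ℕ => klDiv (μ N) (conditioned f N) / (N : ℝ≥0∞)) atTop (𝓝 0)) :
    Tendsto (fun N : ℕ => (∫ v, logTensor f N v ∂μ N) / N) atTop (𝓝 (entropy f)) := by
  have hfin := eventually_ne_top_of_tendsto_div_natCast ENNReal.zero_ne_top hμ
  have hsmall : Icc (-(1 / 2)) (1 / 2) ∈ 𝓝 (0 : ℝ) := Icc_mem_nhds (by norm_num) (by norm_num)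
  refine tendsto_of_mul_le_of_hasDerivAt hf.hasDerivAt_logCgf hf.logCgf_zero ?_
  filter_upwards [hsmall] with t ht c hc
  replace ht := abs_le.2 ht
  obtain ⟨c', hc', hc'c⟩ := exists_between hc
  filter_upwards [hfin, hf.eventually_integrable_logTensor hfin,
    hf.eventually_isProbabilityMeasure_conditioned,
    hf.eventually_mem_integrableExpSet_logTensor ht, hf.eventually_cgf_logTensor_le ht hc',
    (tendsto_toReal_div_natCast ENNReal.zero_ne_top hμ).eventually
      (gt_mem_nhds (sub_pos.2 hc'c)), eventually_gt_atTop 0] with N hN hint _ hmem hcgf hkl hN₀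
  have hN₀' : (0 : ℝ) < N := Nat.cast_pos.2 hN₀
  rw [div_lt_iff₀ hN₀'] at hkl
  rw [← mul_div_assoc, div_le_iff₀ hN₀']
  linarith [mul_integral_le_klDiv_add_cgf hN hint hmem]

end IsKacDensity

end LargeDeviations

end Kac

end

theorem mainTheorem4_general
    (f : ℝ → ℝ) (hf_meas : Measurable f) (hf_nonneg : ∀ v, 0 ≤ f v)
    (hf_mass : ∫ v, f v = 1)
    (hf_second : ∫ v, f v * v ^ 2 = 1)
    (hf_bdd : MemLp f ∞ volume)
    (μ : ∀ N : ℕ, Measure (Kac.Sphere N)) (hμ : ∀ N, IsProbabilityMeasure (μ N))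
    (hH : Tendsto (fun N : ℕ => klDiv (μ N) (Kac.conditioned f N) / (N : ℝ≥0∞)) atTop (𝓝 0)) :
    Tendsto (fun N : ℕ => klDiv (μ N) (Kac.sigma N) / (N : ℝ≥0∞)) atTop
      (𝓝 (klDiv (Kac.densityMeasure f) (gaussianReal 0 1))) := by
  have hf : Kac.IsKacDensity f := ⟨hf_meas, hf_nonneg, hf_mass, hf_second, hf_bdd⟩
  have hfin := Kac.eventually_ne_top_of_tendsto_div_natCast ENNReal.zero_ne_top hH
  have hlim := (Kac.tendsto_toReal_div_natCast ENNReal.zero_ne_top hH).add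
    ((hf.tendsto_integral_logTensor_div hH).sub hf.tendsto_log_Z_div)
  rw [ENNReal.toReal_zero, zero_add, sub_neg_eq_add] at hlim
  rw [hf.klDiv_gaussianReal]
  refine (ENNReal.tendsto_ofReal hlim).congr' ?_
  filter_upwards [hfin, hf.eventually_integrable_logTensor hfin, hf.eventually_Z_ne_zero,
    hf.eventually_Z_ne_top, eventually_gt_atTop 0] with N hN hint h₀ htop hN₀
  have : NeZero N := ⟨hN₀.ne'⟩
  rw [Kac.klDiv_sigma hf_meas h₀ htop hN hint, ← sub_div, ← add_div,
    ENNReal.ofReal_div_of_pos (Nat.cast_pos.2 hN₀), ENNReal.ofReal_natCast]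

theorem mainTheorem4
    (f : ℝ → ℝ) (hf_meas : Measurable f) (hf_nonneg : ∀ v, 0 ≤ f v)
    (hf_mass : ∫ v, f v = 1)
    (hf_second : ∫ v, f v * v ^ 2 = 1)
    (hf_fourth : Integrable (fun v => f v * v ^ 4))
    (hf_bdd : MemLp f ∞ volume)
    (μ : ∀ N : ℕ, Measure (Kac.Sphere N)) (hμ : ∀ N, IsProbabilityMeasure (μ N))
    (hH : Tendsto (fun N : ℕ => klDiv (μ N) (Kac.conditioned f N) / (N : ℝ≥0∞)) atTop (𝓝 0)) :
    Tendsto (fun N : ℕ => klDiv (μ N) (Kac.sigma N) / (N : ℝ≥0∞)) atTop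
      (𝓝 (klDiv (Kac.densityMeasure f) (gaussianReal 0 1))) :=
  mainTheorem4_general f hf_meas hf_nonneg hf_mass hf_second hf_bdd μ hμ hH
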